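/- Let $\mathcal M$ be an oriented matroid on a finite ground set $E$, with underlying matroid $M$ of rank $d$. Let $L=\mathrm{cl}(\emptyset)$ be its set of loops. For $F\subseteq E\setminus L$ put $v_F=-\sum_{i\in F}e_i\in\mathbb R^{E\setminus L}$. The affine matroid fan $\Sigma_M\subseteq\mathbb R^{E\setminus L}$ consists of the cones $$\sigma_{\mathcal F}=\langle v_{F_1},\dots,v_{F_k},v_{E\setminus L},-v_{E\setminus L}\rangle_{\ge 0},$$ where $\mathcal F=\{\emptyset\subsetneq F_1\subsetneq\dots\subsetneq F_k\subsetneq E\setminus L\}$ runs over the flags of flats of $M/L$. Its facets (inclusion-maximal cones) are the cones $\sigma_{\mathcal F}$ of the maximal flags $\mathcal F$. Let $\mathcal C$ be the set of covectors of $\mathcal M\setminus L$ and let $\mathcal T$ be its set of topes, that is, of maximal covectors for the coordinatewise order $0<+1,-1$. For a maximal flag $\mathcal F$ put $$\mathcal T(\mathcal F)=\{T\in\mathcal T : T\setminus F_i\in\mathcal C \text{ for all } i\},$$ where $T\setminus F_i$ is $T$ with the coordinates in $F_i$ set to $0$, and $$\mathcal E_{\mathcal M}(\sigma_{\mathcal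 F})=\{\varepsilon\in(\mathbb Z/2)^{E\setminus L} : (-1)^{\varepsilon}\in\mathcal T(\mathcal F)\}.$$ Then $\mathcal E_{\mathcal M}$ is a well-defined map on the facets of $\Sigma_M$, and it is a real phase structure on $\Sigma_M$. Explicitly, $\Sigma_M$ is a rational polyhedral fan of pure dimension $d$, and: 1. For every facet $\sigma$, the set $\mathcal E_{\mathcal M}(\sigma)$ is a (non-empty) $d$-dimensional affine subspace of $(\mathbb Z/2)^{E\setminus L}$ whose direction is $T_{\mathbb Z_2}(\sigma)$, the reduction mod $2$ of the set of integer points in the real linear span of $\sigma$. 2. For every cone $\tau\in\Sigma_M$ of dimension $d-1$, the sets $\mathcal E_{\mathcal M}(\sigma)$, where $\sigma$ runs over the facets having $\tau$ as a face, form an even covering: every element of their union lies in $\mathcal E_{\mathcal M}(\sigma)$ for an even number of these facets $\sigma$. -/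

import Mathlib

open Set

noncomputable section

/-! ### Oriented matroids through covectors -/

/-- An oriented matroid on the ground set `E`, given by its covectors `X : E → {0, +1, -1}`. -/
structure OrientedMatroid (E : Type*) where
  covectors : Set (E → SignType)
  zero_mem : 0 ∈ covectors
  neg_mem : ∀ X ∈ covectors, -X ∈ covectors
  comp_mem : ∀ X ∈ covectors, ∀ Y ∈ covectors,
    (fun i => if X i ≠ 0 then X i else Y i) ∈ covectors
  elim : ∀ X ∈ covectors, ∀ Y ∈ covectors, ∀ i, X i ≠ 0 → X i = -Y i →
    ∃ Z ∈ covectors, Z i = 0 ∧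
      ∀ j, ¬ (X j ≠ 0 ∧ X j = -Y j) → Z j = if X j ≠ 0 then X j else Y j

namespace OrientedMatroid

variable {E : Type*}

/-- The deletion of `E \ A`: the covectors are the restrictions to `A` of the covectors. -/
def restrict (O : OrientedMatroid E) (A : Set E) : OrientedMatroid A where
  covectors := {Y | ∃ X ∈ O.covectors, Y = fun i : A => X i}
  zero_mem := ⟨0, O.zero_mem, rfl⟩
  neg_mem := by
    rintro _ ⟨X, hX, rfl⟩
    exact ⟨-X, O.neg_mem X hX, rfl⟩
  comp_mem := by
    rintro _ ⟨X, hX, rfl⟩ _ ⟨Y, hY, rfl⟩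
    exact ⟨_, O.comp_mem X hX Y hY, rfl⟩
  elim := by
    rintro _ ⟨X, hX, rfl⟩ _ ⟨Y, hY, rfl⟩ i h0 h1
    obtain ⟨Z, hZ, hZi, hZj⟩ := O.elim X hX Y hY i h0 h1
    exact ⟨_, ⟨Z, hZ, rfl⟩, hZi, fun j hj => hZj j hj⟩

/-- The topes are the maximal covectors for the order `0 < +1, -1` taken coordinatewise. -/
def topes (O : OrientedMatroid E) : Set (E → SignType) :=
  {T | T ∈ O.covectors ∧
    ∀ Y ∈ O.covectors, (∀ i, T i = 0 ∨ T i = Y i) → Y = T}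

/-- The topes adjacent to a family `c` of subsets of `E`: for each `F ∈ c`, setting the
coordinates in `F` to zero gives a covector. -/
def adjacentTopes (O : OrientedMatroid E) (c : Set (Set E)) : Set (E → SignType) :=
  {T | T ∈ O.topes ∧ ∀ F ∈ c, Fᶜ.indicator T ∈ O.covectors}

/-- No nonzero covector vanishes on `A`. -/
def Spans (O : OrientedMatroid E) (A : Set E) : Prop :=
  ∀ X ∈ O.covectors, (∀ i ∈ A, X i = 0) → X = 0

/-- `e` lies in every zero set of a covector that contains `A`. -/
def InSpan (O : OrientedMatroid E) (A : Set E) (e : E) : Prop :=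
  ∀ X ∈ O.covectors, (∀ i ∈ A, X i = 0) → X e = 0

lemma InSpan.exchange {O : OrientedMatroid E} {A : Set E} {e f : E}
    (h : O.InSpan (insert f A) e) (h' : ¬ O.InSpan A e) : O.InSpan (insert e A) f := by
  unfold InSpan at h'
  push Not at h'
  obtain ⟨X, hX, hXA, hXe⟩ := h'
  by_contra hcon
  unfold InSpan at hcon
  push Not at hcon
  obtain ⟨Y, hY, hYA, hYf⟩ := hcon
  have hXf : X f ≠ 0 := by
    intro h0
    refine hXe (h X hX ?_)
    rintro i (rfl | hi)
    exacts [h0, hXA i hi]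
  have hYe : Y e = 0 := hYA e (mem_insert _ _)
  have key : ∀ W ∈ O.covectors, (∀ i ∈ insert e A, W i = 0) → X f ≠ -W f := by
    intro W hW hWA hf
    obtain ⟨Z, hZ, hZf, hZj⟩ := O.elim X hX W hW f hXf hf
    have hWe : W e = 0 := hWA e (mem_insert _ _)
    have hZe : Z e = X e := by
      rw [hZj e (by simp [hWe]), if_pos hXe]
    refine hXe (hZe ▸ h Z hZ ?_)
    rintro i (rfl | hi)
    · exact hZf
    · rw [hZj i (by simp [hXA i hi]), if_neg (by simp [hXA i hi])]
      exact hWA i (mem_insert_of_mem _ hi)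
  rcases (show X f = -Y f ∨ X f = Y f by
    exact (show ∀ a b : SignType, a ≠ 0 → b ≠ 0 → a = -b ∨ a = b by decide) _ _ hXf hYf) with h1 | h1
  · exact key Y hY hYA h1
  · exact key (-Y) (O.neg_mem Y hY) (fun i hi => by simp [hYA i hi]) (by simpa using h1)

lemma not_inSpan_of_minimal {O : OrientedMatroid E} {B : Set E} (hB : Minimal O.Spans B)
    {a : E} (ha : a ∈ B) : ¬ O.InSpan (B \ {a}) a := by
  intro h
  have : O.Spans (B \ {a}) := by
    intro X hX h0
    refine hB.prop X hX fun i hi => ?_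
    by_cases hia : i = a
    · subst hia; exact h X hX h0
    · exact h0 i ⟨hi, hia⟩
  exact (hB.le_of_le this sdiff_subset ha).2 rfl

lemma minimal_of_not_inSpan {O : OrientedMatroid E} {B : Set E} (hB : O.Spans B)
    (h : ∀ a ∈ B, ¬ O.InSpan (B \ {a}) a) : Minimal O.Spans B := by
  refine ⟨hB, fun C hC hCB a ha => ?_⟩
  by_contra haC
  refine h a ha fun X hX h0 => ?_
  have : X = 0 := hC X hX fun i hi => h0 i ⟨hCB hi, fun hia => haC (hia ▸ hi)⟩
  simp [this]

lemma InSpan.mono {O : OrientedMatroid E} {A B : Set E} {e : E} (h : O.InSpan A e)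
    (hAB : A ⊆ B) : O.InSpan B e :=
  fun X hX h0 => h X hX fun i hi => h0 i (hAB hi)

lemma not_inSpan_insert {O : OrientedMatroid E} {I : Set E} {b : E}
    (hI : ∀ a ∈ I, ¬ O.InSpan (I \ {a}) a) (hb : ¬ O.InSpan I b) :
    ∀ a ∈ insert b I, ¬ O.InSpan (insert b I \ {a}) a := by
  have hbI : b ∉ I := fun h => hb fun X _ h0 => h0 b h
  rintro a (rfl | ha) h
  · exact hb (h.mono (by rintro x ⟨rfl | hx, hx'⟩ <;> simp_all))
  · have hab : b ≠ a := fun hab => hbI (hab ▸ ha)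
    have h1 : O.InSpan (insert b (I \ {a})) a :=
      h.mono (by rintro x ⟨rfl | hx, hx'⟩ <;> simp_all)
    exact hb ((h1.exchange (hI a ha)).mono (by
      rintro x (rfl | hx)
      exacts [ha, hx.1]))

/-- The underlying matroid of an oriented matroid. Its flats are the zero sets of the covectors
(see `underlying_isFlat_iff`); equivalently its bases are the minimal sets on which no nonzero
covector vanishes. -/
def underlying [Finite E] (O : OrientedMatroid E) : Matroid E :=
  Matroid.ofIsBaseOfFinite (E := univ) finite_univ (Minimal O.Spans)
    (by
      obtain ⟨B, -, hB⟩ := (toFinite {B | O.Spans B}).exists_le_minimal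
        (show O.Spans univ from fun X _ h => funext fun i => h i trivial)
      exact ⟨B, hB⟩)
    (by
      rintro B₁ B₂ h₁ h₂ a ⟨ha, ha'⟩
      have : ∃ b ∈ B₂, ¬ O.InSpan (B₁ \ {a}) b := by
        by_contra! hcon
        refine not_inSpan_of_minimal h₁ ha fun X hX h0 => ?_
        have : X = 0 := h₂.prop X hX fun i hi => hcon i hi X hX h0
        simp [this]
      obtain ⟨b, hb, hbs⟩ := this
      have hba : b ≠ a := fun h => ha' (h ▸ hb)
      have hb1 : b ∉ B₁ := fun h => hbs fun X _ h0 => h0 b ⟨h, hba⟩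
      refine ⟨b, ⟨hb, hb1⟩, minimal_of_not_inSpan ?_ (not_inSpan_insert ?_ hbs)⟩
      · intro X hX h0
        refine h₁.prop X hX fun i hi => ?_
        by_cases hia : i = a
        · subst hia
          have hB : O.InSpan (insert i (B₁ \ {i})) b := by
            rw [insert_sdiff_self_of_mem hi]
            intro Y hY hY0
            simp [h₁.prop Y hY hY0]
          exact hB.exchange hbs X hX h0
        · exact h0 i (mem_insert_of_mem _ ⟨hi, hia⟩)
      · rintro x ⟨hx, -⟩ h
        exact not_inSpan_of_minimal h₁ hx (h.mono fun y hy => ⟨hy.1.1, hy.2⟩))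
    (fun _ _ => subset_univ _)

lemma underlying_indep_iff [Finite E] (O : OrientedMatroid E) (I : Set E) :
    O.underlying.Indep I ↔ ∀ a ∈ I, ¬ O.InSpan (I \ {a}) a := by
  rw [Matroid.indep_iff]
  constructor
  · rintro ⟨B, hB, hIB⟩ a ha h
    exact not_inSpan_of_minimal (B := B) hB (hIB ha) (h.mono (sdiff_subset_sdiff_left hIB))
  · intro h
    obtain ⟨B, hIB, hB⟩ :=
      (toFinite {B : Set E | ∀ a ∈ B, ¬ O.InSpan (B \ {a}) a}).exists_le_maximal h
    refine ⟨B, minimal_of_not_inSpan ?_ hB.prop, hIB⟩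
    intro X hX h0
    funext e
    by_contra he
    have hne : ¬ O.InSpan B e := fun hs => he (hs X hX h0)
    have := hB.le_of_ge (not_inSpan_insert hB.prop hne) (subset_insert _ _) (mem_insert e B)
    exact he (h0 e this)

lemma underlying_mem_closure_iff [Finite E] (O : OrientedMatroid E) (A : Set E) (e : E) :
    e ∈ O.underlying.closure A ↔ O.InSpan A e := by
  have hE : O.underlying.E = univ := rfl
  obtain ⟨I, hI⟩ := O.underlying.exists_isBasis A (by simp [hE])
  have hcl : ∀ x, x ∈ O.underlying.closure I ↔ O.InSpan I x := by
    intro x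
    rw [hI.indep.mem_closure_iff']
    have hI' := (O.underlying_indep_iff I).1 hI.indep
    constructor
    · rintro ⟨-, h⟩
      by_contra hx
      exact hx fun X _ h0 => h0 x
        (h ((O.underlying_indep_iff _).2 (not_inSpan_insert hI' hx)))
    · intro h
      refine ⟨trivial, fun hi => ?_⟩
      by_contra hx
      exact (O.underlying_indep_iff _).1 hi x (mem_insert _ _) (h.mono (by
        intro y hy
        exact ⟨mem_insert_of_mem _ hy, fun hyx => hx (hyx ▸ hy)⟩))
  rw [← hI.closure_eq_closure, hcl]
  refine ⟨fun h => h.mono hI.subset, fun h X hX h0 => h X hX fun i hi => ?_⟩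
  exact (hcl i).1 (hI.subset_closure hi) X hX h0

/-- The flats of the underlying matroid are exactly the zero sets of the covectors. -/
theorem underlying_isFlat_iff [Finite E] (O : OrientedMatroid E) (F : Set E) :
    O.underlying.IsFlat F ↔ ∃ X ∈ O.covectors, F = {i | X i = 0} := by
  rw [Matroid.isFlat_iff_closure_eq]
  constructor
  · intro h
    obtain ⟨F', hF'⟩ : ∃ F', Minimal (fun S => ∃ X ∈ O.covectors, F ⊆ S ∧ S = {i | X i = 0}) F' := by
      obtain ⟨F', -, hF'⟩ := (toFinite
        {S | ∃ X ∈ O.covectors, F ⊆ S ∧ S = {i | X i = 0}}).exists_le_minimal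
        (show univ ∈ _ from ⟨0, O.zero_mem, subset_univ _, by simp⟩)
      exact ⟨F', hF'⟩
    obtain ⟨X, hX, hFX, rfl⟩ := hF'.prop
    refine ⟨X, hX, hFX.antisymm fun e he => ?_⟩
    rw [← h, underlying_mem_closure_iff]
    intro Y hY hY0
    have := hF'.le_of_le (y := {i | X i = 0 ∧ Y i = 0})
      ⟨_, O.comp_mem X hX Y hY, fun i hi => ⟨hFX hi, hY0 i hi⟩, by
        ext i; by_cases hi : X i = 0 <;> simp [hi]⟩ (fun i hi => hi.1) he
    exact this.2
  · rintro ⟨X, hX, rfl⟩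
    refine Subset.antisymm (fun e he => ?_) (O.underlying.subset_closure _ (subset_univ _))
    exact (O.underlying_mem_closure_iff _ e).1 he X hX fun i hi => hi

end OrientedMatroid

/-! ### Rational polyhedral fans and real phase structures -/

section Fan

variable {ι : Type*}

/-- A rational polyhedral fan in `ℝ^ι`: a finite collection of cones generated by finitely many
integer vectors, closed under taking faces, in which any two cones meet in a common face. -/
structure IsRationalFan (Δ : Set (PointedCone ℝ (ι → ℝ))) : Prop where
  finite : Δ.Finite
  rational : ∀ σ ∈ Δ, ∃ S : Finset (ι → ℤ),
    σ = PointedCone.hull ℝ ((fun (z : ι → ℤ) (i : ι) => (z i : ℝ)) '' (S : Set (ι → ℤ)))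
  face_mem : ∀ σ ∈ Δ, ∀ τ : PointedCone ℝ (ι → ℝ), τ.IsFaceOf σ → τ ∈ Δ
  inf_isFaceOf : ∀ σ ∈ Δ, ∀ τ ∈ Δ, (σ ⊓ τ).IsFaceOf σ ∧ (σ ⊓ τ).IsFaceOf τ

/-- The facets of a fan: its cones that are maximal with respect to inclusion. -/
def Facets (Δ : Set (PointedCone ℝ (ι → ℝ))) : Set (PointedCone ℝ (ι → ℝ)) :=
  {σ | Maximal (· ∈ Δ) σ}

/-- The tangent space `T(σ)`: the real span of a cone. -/
def coneTangent (σ : PointedCone ℝ (ι → ℝ)) : Submodule ℝ (ι → ℝ) :=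
  Submodule.span ℝ (σ : Set (ι → ℝ))

/-- The dimension of a cone. -/
def coneDim (σ : PointedCone ℝ (ι → ℝ)) : ℕ := Module.finrank ℝ (coneTangent σ)

/-- `T_ℤ(σ)`: the integer points of the tangent space. -/
def coneTangentInt (σ : PointedCone ℝ (ι → ℝ)) : AddSubgroup (ι → ℤ) :=
  (coneTangent σ).toAddSubgroup.comap ((Int.castAddHom ℝ).compLeft ι)

/-- `T_{ℤ/2}(σ)`: the reduction mod 2 of the integer points of the tangent space. -/
def coneTangentMod2 (σ : PointedCone ℝ (ι → ℝ)) : Submodule (ZMod 2) (ι → ZMod 2) :=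
  AddSubgroup.toZModSubmodule 2
    ((coneTangentInt σ).map ((Int.castAddHom (ZMod 2)).compLeft ι))

/-- An indexed family of subsets is an even covering if every element of the union lies in an
even (in particular finite) number of members of the family. -/
def IsEvenCovering {κ α : Type*} (A : κ → Set α) : Prop :=
  ∀ x ∈ ⋃ k, A k, {k | x ∈ A k}.Finite ∧ Even {k | x ∈ A k}.ncard

/-- `𝓔` is a real phase structure on the collection of cones `Δ`, where `Δ` is a rational
polyhedral fan of pure dimension `d`. -/
structure IsRealPhaseStructure (Δ : Set (PointedCone ℝ (ι → ℝ))) (d : ℕ)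
    (𝓔 : Facets Δ → Set (ι → ZMod 2)) : Prop where
  isRationalFan : IsRationalFan Δ
  pure : ∀ σ ∈ Facets Δ, coneDim σ = d
  parallel : ∀ σ : Facets Δ, ∃ A : AffineSubspace (ZMod 2) (ι → ZMod 2),
    (A : Set (ι → ZMod 2)) = 𝓔 σ ∧ (A : Set (ι → ZMod 2)).Nonempty ∧
    Module.finrank (ZMod 2) A.direction = d ∧ A.direction = coneTangentMod2 (σ : PointedCone ℝ _)
  evenCovering : ∀ τ ∈ Δ, coneDim τ + 1 = d →
    IsEvenCovering fun σ : {σ : Facets Δ // τ.IsFaceOf (σ : PointedCone ℝ (ι → ℝ))} => 𝓔 σ.1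

end Fan

/-! ### Matroid fans -/

namespace Matroid

variable {α : Type*}

/-- `v_F = ∑_{i ∈ F} -e_i`. -/
def flatVector (F : Set α) : α → ℝ := -F.indicator 1

/-- A flag `∅ ⊊ F₁ ⊊ ⋯ ⊊ F_k ⊊ E` of flats, recorded as the set `{F₁, …, F_k}`. -/
def IsFlag (N : Matroid α) (c : Set (Set α)) : Prop :=
  (∀ F ∈ c, N.IsFlat F ∧ F.Nonempty ∧ F ≠ N.E) ∧ IsChain (· ⊆ ·) c

/-- A maximal flag of flats. -/
def IsMaximalFlag (N : Matroid α) (c : Set (Set α)) : Prop := Maximal N.IsFlag c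

/-- The cone generated by `v_{F₁}, …, v_{F_k}, v_E, -v_E`. -/
def flagCone (N : Matroid α) (c : Set (Set α)) : PointedCone ℝ (α → ℝ) :=
  PointedCone.hull ℝ (flatVector '' c ∪ {flatVector N.E, -flatVector N.E})

/-- The affine fan of a matroid without loops. -/
def loopfreeFan (N : Matroid α) : Set (PointedCone ℝ (α → ℝ)) :=
  {σ | ∃ c, N.IsFlag c ∧ σ = N.flagCone c}

/-- For `L` the set of loops of `M`, the matroid `M / L`, on the type of elements of `E \ L`. -/
def loopfreePart (M : Matroid α) : Matroid (M.E \ M.loops : Set α) :=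
  (M.contract M.loops).restrictSubtype (M.E \ M.loops)

/-- The affine matroid fan `Σ_M = Σ_{M / L}` in `ℝ^{E \ L}`, with `L` the set of loops of `M`. -/
def affineFan (M : Matroid α) : Set (PointedCone ℝ ((M.E \ M.loops : Set α) → ℝ)) :=
  M.loopfreePart.loopfreeFan

end Matroid

/-! ### From oriented matroids to real phase structures -/

namespace OrientedMatroid

variable {E : Type*} [Finite E]

/-- The ground set without the loops. -/
abbrev NonLoop (O : OrientedMatroid E) : Type _ :=
  (O.underlying.E \ O.underlying.loops : Set E)

/-- The oriented matroid obtained by deleting the loops. -/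
def deleteLoops (O : OrientedMatroid E) : OrientedMatroid O.NonLoop :=
  O.restrict (O.underlying.E \ O.underlying.loops)

/-- `{ε | (-1)^ε ∈ 𝓣(c)}`, for a flag `c`. -/
def flagPhase (O : OrientedMatroid E) (c : Set (Set O.NonLoop)) : Set (O.NonLoop → ZMod 2) :=
  {ε | (fun i => (-1 : SignType) ^ (ε i).val) ∈ O.deleteLoops.adjacentTopes c}

/-- The map `𝓔` on the facets of `Σ_M`: the facet `σ` corresponding to the maximal flag `c`
is sent to `{ε | (-1)^ε ∈ 𝓣(c)}`. -/
def realPhase (O : OrientedMatroid E) (σ : Facets O.underlying.affineFan) :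
    Set (O.NonLoop → ZMod 2) :=
  {ε | ∃ c, O.underlying.loopfreePart.IsMaximalFlag c ∧
    O.underlying.loopfreePart.flagCone c = σ ∧ ε ∈ O.flagPhase c}

end OrientedMatroid

end

noncomputable section

/-! ### Loops -/

namespace OrientedMatroid

variable {E : Type*}

/-! Deleting the loops of the oriented matroid yields an oriented matroid whose underlying matroid
is `loopfreePart` (`loopfreePart_eq`). So the matroid may be taken loopless, with flats the zero
sets of covectors.

The fan geometry reduces to combinatorics: a vector `x` lies in the cone of a flag exactly when
every proper lower cut of `x` belongs to the flag (`mem_flagCone_iff`). Hence faces are subflags,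
intersections of cones are intersections of flags, and facets are maximal flags. The span of a cone
has the indicators of the members of the flag and of the ground set as a basis, both over the reals
and mod 2.

For the affine structure, take a maximal flag. Flipping the signs of an adjacent tope on a member of
the flag gives another adjacent tope (`flip_mem_adjacentTopes`), so the phase is stable under
translation by the indicators. Conversely, each gap of the flag is a rank-one minor, where a nonzero
covector is determined up to sign (`elim_of_covers`). Two adjacent topes therefore differ by a sign
that is constant on each gap, that is, by a combination of indicators.

For the even covering, dropping one flat from a maximal flag leaves a single interval of rank two.
There the covectors behave like the cells of a circle cut by diameters: a tope is an arc with
exactly two endpoints (`exists_opposite`). So a sign vector in the phase of one facet around a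
codimension-one cone lies in the phase of exactly one other (`exists_opposite_flag`). -/

lemma restrict_inSpan_iff (O : OrientedMatroid E) (A : Set E) (B : Set A) (e : A) :
    (O.restrict A).InSpan B e ↔ O.InSpan ((↑) '' B) e := by
  constructor
  · intro h X hX h0
    exact h _ ⟨X, hX, rfl⟩ fun i hi => h0 i ⟨i, hi, rfl⟩
  · rintro h _ ⟨X, hX, rfl⟩ h0
    refine h X hX ?_
    rintro _ ⟨i, hi, rfl⟩
    exact h0 i hi

variable [Finite E]

lemma loopfreePart_indep_iff (O : OrientedMatroid E) (I : Set O.NonLoop) :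
    O.underlying.loopfreePart.Indep I ↔ O.underlying.Indep ((↑) '' I) := by
  rw [Matroid.loopfreePart, Matroid.restrictSubtype_indep_iff,
    Matroid.contract_eq_delete_of_subset_loops Subset.rfl, Matroid.delete_indep_iff,
    and_iff_left_iff_imp]
  rintro -
  rw [disjoint_left]
  rintro _ ⟨i, -, rfl⟩
  exact i.2.2

/-- Contracting loops is the same as deleting them, and spanning inside the deletion is spanning in
the original by `restrict_inSpan_iff`. This makes covectors available for the flats of
`loopfreePart`. -/
lemma loopfreePart_eq (O : OrientedMatroid E) :
    O.underlying.loopfreePart = O.deleteLoops.underlying := by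
  refine Matroid.ext_indep ?_ fun I _ => ?_
  · exact Matroid.restrictSubtype_ground
  · rw [loopfreePart_indep_iff, underlying_indep_iff, underlying_indep_iff]
    simp only [forall_mem_image, deleteLoops]
    refine forall₂_congr fun a _ => not_congr ?_
    refine Iff.trans ?_ (restrict_inSpan_iff O _ _ _).symm
    rw [image_sdiff Subtype.val_injective, image_singleton]

lemma loopfreePart_eRank (O : OrientedMatroid E) :
    O.underlying.loopfreePart.eRank = O.underlying.eRank := by
  obtain ⟨B, hB⟩ := O.underlying.exists_isBase
  have hBE : B ⊆ O.underlying.E \ O.underlying.loops := fun x hx =>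
    ⟨hB.subset_ground hx, fun hl => (hB.indep.isNonloop_of_mem hx).not_isLoop hl⟩
  have himg : ((↑) : O.NonLoop → E) '' ((↑) ⁻¹' B) = B := by
    simpa using hBE
  have : O.underlying.loopfreePart.IsBase ((↑) ⁻¹' B) := by
    rw [Matroid.isBase_iff_maximal_indep]
    refine ⟨(loopfreePart_indep_iff O _).2 (by rw [himg]; exact hB.indep), fun J hJ hBJ => ?_⟩
    have h1 := hB.eq_of_subset_indep ((loopfreePart_indep_iff O J).1 hJ)
      (himg ▸ image_mono hBJ)
    intro x hx
    rw [mem_preimage, h1]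
    exact ⟨x, hx, rfl⟩
  rw [← this.encard_eq_eRank, ← hB.encard_eq_eRank]
  conv_rhs => rw [← himg, Subtype.val_injective.encard_image]

lemma deleteLoops_underlying_loopless (O : OrientedMatroid E) :
    O.deleteLoops.underlying.Loopless := by
  rw [← loopfreePart_eq, Matroid.loopless_iff_forall_isNonloop]
  intro e _
  rw [← Matroid.indep_singleton, loopfreePart_indep_iff, image_singleton, Matroid.indep_singleton]
  exact ⟨e.2.2, e.2.1⟩

end OrientedMatroid

/-! ### Ranks along flags of flats -/

namespace Matroid

variable {α : Type*}

/-- The members of a flag together with the ground set, without the empty set. -/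
def extendedFlag (N : Matroid α) (c : Set (Set α)) : Set (Set α) :=
  {F | F ∈ insert N.E c ∧ F.Nonempty}

/-- The rank of a set, as a natural number. -/
def natRk (N : Matroid α) (F : Set α) : ℕ := (N.eRk F).toNat

variable {N : Matroid α} {F G : Set α} {c c' : Set (Set α)}

lemma IsFlag.isFlat (hc : N.IsFlag c) (hF : F ∈ N.extendedFlag c) : N.IsFlat F := by
  rcases hF.1 with rfl | h
  exacts [N.ground_isFlat, (hc.1 F h).1]

lemma IsFlag.isChain (hc : N.IsFlag c) : IsChain (· ⊆ ·) (N.extendedFlag c) := by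
  have : IsChain (· ⊆ ·) (insert N.E c) :=
    hc.2.insert fun F hF _ => Or.inr (hc.1 F hF).1.subset_ground
  exact this.mono fun F hF => hF.1

lemma natRk_empty : N.natRk ∅ = 0 := by simp [natRk]

lemma extendedFlag_mono (h : c ⊆ c') : N.extendedFlag c ⊆ N.extendedFlag c' :=
  fun _ hF => ⟨insert_subset_insert h hF.1, hF.2⟩

lemma mem_of_mem_extendedFlag (hF : F ∈ N.extendedFlag c)
    (hFE : F ≠ N.E) : F ∈ c := hF.1.resolve_left hFE

lemma IsFlag.mem_extendedFlag (hc : N.IsFlag c) (hF : F ∈ c) : F ∈ N.extendedFlag c :=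
  ⟨mem_insert_of_mem _ hF, (hc.1 F hF).2.1⟩

lemma IsFlag.subset (hc : N.IsFlag c) (h : c' ⊆ c) : N.IsFlag c' :=
  ⟨fun F hF => hc.1 F (h hF), hc.2.mono h⟩

lemma IsFlat.inter (hF : N.IsFlat F) (hG : N.IsFlat G) : N.IsFlat (F ∩ G) := by
  rw [inter_eq_iInter]
  exact IsFlat.iInter fun b => by cases b <;> assumption

lemma isFlat_empty [N.Loopless] : N.IsFlat ∅ := by
  rw [isFlat_iff_closure_eq, closure_empty, loops_eq_empty]

lemma IsFlag.isFlat_of_mem_insert [N.Loopless] (hc : N.IsFlag c)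
    (hF : F ∈ insert ∅ (N.extendedFlag c)) : N.IsFlat F := by
  rcases hF with rfl | hF
  exacts [isFlat_empty, hc.isFlat hF]

lemma IsFlag.isChain_insert (hc : N.IsFlag c) :
    IsChain (· ⊆ ·) (insert ∅ (N.extendedFlag c)) :=
  hc.isChain.insert fun _ _ _ => Or.inl (empty_subset _)

/-- An empty ground set is not in `extendedFlag`, where it would spoil the dimension count;
adjoining `∅` covers that case. -/
lemma ground_mem_insert : N.E ∈ insert ∅ (N.extendedFlag c) := by
  rcases N.E.eq_empty_or_nonempty with h | h
  · rw [h]; exact mem_insert _ _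
  · exact mem_insert_of_mem _ ⟨mem_insert _ _, h⟩

/-- A maximal flag contains all flats that are comparable with its members. -/
lemma IsMaximalFlag.mem_insert_of_comparable (hc : N.IsMaximalFlag c) {H : Set α}
    (hH : N.IsFlat H) (h : ∀ K ∈ insert ∅ (N.extendedFlag c), H ⊆ K ∨ K ⊆ H) :
    H ∈ insert ∅ (N.extendedFlag c) := by
  rcases H.eq_empty_or_nonempty with rfl | hne
  · exact mem_insert _ _
  by_cases hHE : H = N.E
  · rw [hHE]; exact ground_mem_insert
  have hflag : N.IsFlag (insert H c) := by
    refine ⟨?_, hc.prop.2.insert fun K hK _ =>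
      h K (mem_insert_of_mem _ (hc.prop.mem_extendedFlag hK))⟩
    rintro K (rfl | hK)
    exacts [⟨hH, hne, hHE⟩, hc.prop.1 K hK]
  exact mem_insert_of_mem _ (hc.prop.mem_extendedFlag
    (hc.le_of_ge hflag (subset_insert _ _) (mem_insert _ _)))

lemma IsFlag.subset_of_extendedFlag_subset (hc : N.IsFlag c)
    (h : N.extendedFlag c ⊆ N.extendedFlag c') : c ⊆ c' := fun F hF =>
  mem_of_mem_extendedFlag (h (hc.mem_extendedFlag hF)) (hc.1 F hF).2.2

lemma extendedFlag_insert {H : Set α} (hH : H.Nonempty) :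
    N.extendedFlag (insert H c) = insert H (N.extendedFlag c) := by
  ext F
  simp only [extendedFlag, mem_insert_iff, mem_ofPred_eq]
  grind

variable [Finite α]
lemma coe_natRk : (N.natRk F : ℕ∞) = N.eRk F :=
  ENat.natCast_toNat (eRk_ne_top_iff.2 (N.isRkFinite_of_finite (toFinite F)))

lemma natRk_mono (h : F ⊆ G) : N.natRk F ≤ N.natRk G := by
  have := N.eRk_mono h
  rw [← coe_natRk, ← coe_natRk] at this
  exact_mod_cast this

lemma IsFlat.natRk_lt (hF : N.IsFlat F) (hG : N.IsFlat G) (h : F ⊂ G) :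
    N.natRk F < N.natRk G := by
  refine (natRk_mono h.subset).lt_of_ne fun he => h.ne ?_
  rw [← hF.closure, ← hG.closure]
  refine (N.isRkFinite_of_finite (toFinite F)).closure_eq_closure_of_subset_of_eRk_ge_eRk
    h.subset ?_
  rw [← coe_natRk, ← coe_natRk, he]

lemma IsFlat.exists_natRk_succ (hF : N.IsFlat F) (hG : N.IsFlat G)
    (h : N.natRk F < N.natRk G) (hFG : F ⊆ G) :
    ∃ H, N.IsFlat H ∧ F ⊆ H ∧ H ⊆ G ∧ N.natRk H = N.natRk F + 1 := by
  have hlt : N.eRk F < N.eRk G := by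
    rw [← coe_natRk, ← coe_natRk]; exact_mod_cast h
  obtain ⟨y, hy, hr⟩ := exists_eRk_insert_eq_add_one_of_lt hlt
  have hyE : insert y F ⊆ N.E := insert_subset (hG.subset_ground hy.1) hF.subset_ground
  refine ⟨N.closure (insert y F), N.isFlat_closure _,
    (subset_insert _ _).trans (N.subset_closure _ hyE), ?_, ?_⟩
  · rw [← hG.closure]
    exact N.closure_subset_closure (insert_subset hy.1 hFG)
  · have : (N.natRk (N.closure (insert y F)) : ℕ∞) = (N.natRk F + 1 : ℕ) := by
      rw [coe_natRk, eRk_closure_eq, hr, ← coe_natRk]; rfl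
    exact_mod_cast this

lemma IsFlag.subset_of_natRk_le (hc : N.IsFlag c) (hF : F ∈ N.extendedFlag c)
    (hG : G ∈ N.extendedFlag c) (h : N.natRk F ≤ N.natRk G) : F ⊆ G := by
  rcases hc.isChain.total hF hG with h' | h'
  · exact h'
  · by_contra hcon
    exact ((hc.isFlat hG).natRk_lt (hc.isFlat hF) ⟨h', hcon⟩).not_ge h

lemma IsFlag.natRk_injOn (hc : N.IsFlag c) : InjOn N.natRk (N.extendedFlag c) :=
  fun _ hF _ hG h => (hc.subset_of_natRk_le hF hG h.le).antisymm
    (hc.subset_of_natRk_le hG hF h.ge)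

lemma natRk_pos [N.Loopless] (hFE : F ⊆ N.E) (hF : F.Nonempty) : 0 < N.natRk F := by
  rw [Nat.pos_iff_ne_zero]
  intro h
  have : N.eRk F = 0 := by rw [← coe_natRk, h]; rfl
  rw [eRk_eq_zero_iff hFE, loops_eq_empty] at this
  exact hF.ne_empty (subset_empty_iff.1 this)

lemma IsFlag.mapsTo [N.Loopless] (hc : N.IsFlag c) :
    MapsTo N.natRk (N.extendedFlag c) (Icc 1 (N.natRk N.E)) := fun _ hF =>
  ⟨natRk_pos (hc.isFlat hF).subset_ground hF.2, natRk_mono (hc.isFlat hF).subset_ground⟩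

/-- Rank is injective on a chain of flats, and nonempty flats of a loopless matroid have positive
rank. -/
lemma IsFlag.ncard_le [N.Loopless] (hc : N.IsFlag c) :
    (N.extendedFlag c).ncard ≤ N.natRk N.E := by
  have := ncard_le_ncard_of_injOn _ hc.mapsTo hc.natRk_injOn
  simpa [ncard_eq_toFinset_card'] using this

lemma IsFlag.isMaximalFlag [N.Loopless] (hc : N.IsFlag c)
    (h : (N.extendedFlag c).ncard = N.natRk N.E) : N.IsMaximalFlag c := by
  refine ⟨hc, fun c' hc' hcc' F hF => ?_⟩
  have := eq_of_subset_of_ncard_le (extendedFlag_mono (N := N) hcc') (h ▸ hc'.ncard_le)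
  exact mem_of_mem_extendedFlag (this ▸ hc'.mem_extendedFlag hF) (hc'.1 F hF).2.2

/-- A maximal flag contains flats of all ranks. -/
lemma IsMaximalFlag.exists_natRk_eq [N.Loopless] (hc : N.IsMaximalFlag c) {r : ℕ}
    (hr : r ≤ N.natRk N.E) : ∃ F ∈ insert ∅ (N.extendedFlag c), N.natRk F = r := by
  have hchain := hc.prop.isChain_insert
  obtain ⟨F, ⟨hFc, hFr⟩, hFmax⟩ :=
    (toFinite {F ∈ insert ∅ (N.extendedFlag c) | N.natRk F ≤ r}).exists_maximal
      ⟨∅, mem_insert _ _, by simp [natRk_empty]⟩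
  refine ⟨F, hFc, hFr.eq_of_not_lt fun hlt => ?_⟩
  -- The alternative `F = N.E` keeps this family nonempty when `r` is the full rank. If `F` had rank
  -- below `r`, a flat of rank one higher between `F` and `G` would be comparable with the whole
  -- flag, hence in it, against the maximality of `F`.
  obtain ⟨G, ⟨hGc, hGr⟩, hGmin⟩ :=
    (toFinite {F ∈ insert ∅ (N.extendedFlag c) | r < N.natRk F ∨ F = N.E}).exists_minimal
      ⟨N.E, ground_mem_insert, Or.inr rfl⟩
  have hGr' : r ≤ N.natRk G := by
    rcases hGr with h | rfl
    exacts [h.le, hr]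
  have hFG : F ⊆ G := by
    rcases hchain.total hFc hGc with h | h
    · exact h
    · exact absurd (natRk_mono (N := N) h) (by omega)
  obtain ⟨H, hH, hFH, hHG, hHr⟩ := (hc.prop.isFlat_of_mem_insert hFc).exists_natRk_succ
    (hc.prop.isFlat_of_mem_insert hGc) (hlt.trans_le hGr') hFG
  have hHc : H ∈ insert ∅ (N.extendedFlag c) := by
    refine hc.mem_insert_of_comparable hH fun K hK => ?_
    by_cases hKr : N.natRk K ≤ r
    · refine Or.inr (Subset.trans ?_ hFH)
      rcases hchain.total hK hFc with h | h
      exacts [h, hFmax ⟨hK, hKr⟩ h]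
    · refine Or.inl (hHG.trans ?_)
      rcases hchain.total hGc hK with h | h
      exacts [h, hGmin ⟨hK, Or.inl (not_le.1 hKr)⟩ h]
  have := natRk_mono (N := N) (hFmax ⟨hHc, by omega⟩ hFH)
  omega

/-- Every element of the ground set is separated by two consecutive members of a maximal flag. -/
lemma IsMaximalFlag.exists_gap [N.Loopless] (hc : N.IsMaximalFlag c) {i : α} (hi : i ∈ N.E) :
    ∃ F ∈ insert ∅ (N.extendedFlag c), ∃ G ∈ N.extendedFlag c, i ∉ F ∧ i ∈ G ∧ F ⊆ G ∧
      ∀ H, N.IsFlat H → F ⊆ H → H ⊆ G → H = F ∨ H = G := by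
  have hchain := hc.prop.isChain_insert
  obtain ⟨F, ⟨hFc, hFi⟩, hFmax⟩ :=
    (toFinite {F ∈ insert ∅ (N.extendedFlag c) | i ∉ F}).exists_maximal
      ⟨∅, mem_insert _ _, notMem_empty i⟩
  obtain ⟨G, ⟨hGc, hGi⟩, hGmin⟩ :=
    (toFinite {F ∈ insert ∅ (N.extendedFlag c) | i ∈ F}).exists_minimal
      ⟨N.E, ground_mem_insert, hi⟩
  have hlow : ∀ K ∈ insert ∅ (N.extendedFlag c), i ∉ K → K ⊆ F := fun K hK hKi => by
    rcases hchain.total hK hFc with h | h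
    exacts [h, hFmax ⟨hK, hKi⟩ h]
  have hhigh : ∀ K ∈ insert ∅ (N.extendedFlag c), i ∈ K → G ⊆ K := fun K hK hKi => by
    rcases hchain.total hGc hK with h | h
    exacts [h, hGmin ⟨hK, hKi⟩ h]
  refine ⟨F, hFc, G, hGc.resolve_left (by rintro rfl; exact hGi), hFi, hGi, ?_, ?_⟩
  · rcases hchain.total hFc hGc with h | h
    exacts [h, absurd (h hGi) hFi]
  · intro H hH hFH hHG
    have hHc : H ∈ insert ∅ (N.extendedFlag c) := by
      refine hc.mem_insert_of_comparable hH fun K hK => ?_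
      by_cases hKi : i ∈ K
      exacts [Or.inl (hHG.trans (hhigh K hK hKi)), Or.inr ((hlow K hK hKi).trans hFH)]
    by_cases hHi : i ∈ H
    exacts [Or.inr (hHG.antisymm (hhigh H hHc hHi)), Or.inl ((hlow H hHc hHi).antisymm hFH)]

lemma IsMaximalFlag.image_natRk [N.Loopless] (hc : N.IsMaximalFlag c) :
    N.natRk '' N.extendedFlag c = Icc 1 (N.natRk N.E) := by
  refine hc.prop.mapsTo.image_subset.antisymm fun r hr => ?_
  obtain ⟨F, rfl | hF, rfl⟩ := hc.exists_natRk_eq hr.2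
  · simp [natRk_empty] at hr
  · exact ⟨F, hF, rfl⟩

lemma IsMaximalFlag.ncard_eq [N.Loopless] (hc : N.IsMaximalFlag c) :
    (N.extendedFlag c).ncard = N.natRk N.E := by
  rw [← hc.prop.natRk_injOn.ncard_image, hc.image_natRk]
  simp [ncard_eq_toFinset_card']

/-- The missing flat of a flag that is contained in a maximal flag with one more member. -/
lemma IsMaximalFlag.exists_extendedFlag_eq_insert [N.Loopless] (hc' : N.IsMaximalFlag c')
    (hcc : c ⊆ c') (hcard : (N.extendedFlag c).ncard + 1 = N.natRk N.E) :
    ∃ H ∉ N.extendedFlag c, H ∈ c' ∧ N.extendedFlag c' = insert H (N.extendedFlag c) := by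
  have hsub := extendedFlag_mono (N := N) hcc
  obtain ⟨H, hH⟩ : ∃ H, N.extendedFlag c' \ N.extendedFlag c = {H} := by
    rw [← ncard_eq_one, ncard_sdiff hsub, hc'.ncard_eq, ← hcard]
    simp
  obtain ⟨hH1, hH2⟩ : H ∈ N.extendedFlag c' \ N.extendedFlag c := hH ▸ mem_singleton H
  refine ⟨H, hH2, mem_of_mem_extendedFlag hH1 ?_, ?_⟩
  · rintro rfl
    exact hH2 ⟨mem_insert _ _, hH1.2⟩
  · rw [← sdiff_union_of_subset hsub, hH, singleton_union]

end Matroid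

/-! ### Topes adjacent to a chain of flats -/

namespace OrientedMatroid

variable {α : Type*} {O : OrientedMatroid α} {F G : Set α} {c : Set (Set α)}
  {T X Y Z : α → SignType}

/-- The sign vectors `ε ↦ (-1)^ε`. -/
def signVector (ε : α → ZMod 2) (i : α) : SignType := (-1) ^ (ε i).val

/-- `{ε | (-1)^ε ∈ 𝓣(c)}`. -/
def phase (O : OrientedMatroid α) (c : Set (Set α)) : Set (α → ZMod 2) :=
  {ε | signVector ε ∈ O.adjacentTopes c}

lemma exists_signVector_eq (hT : ∀ i, T i ≠ 0) : ∃ ε, signVector ε = T := by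
  have : ∀ s : SignType, s ≠ 0 → ∃ a : ZMod 2, (-1 : SignType) ^ a.val = s := by decide
  choose ε hε using fun i => this (T i) (hT i)
  exact ⟨ε, funext hε⟩

variable [Finite α]

lemma isFlat_inter_zeros (hG : O.underlying.IsFlat G) (hZ : Z ∈ O.covectors) :
    O.underlying.IsFlat (G ∩ {i | Z i = 0}) :=
  hG.inter ((O.underlying_isFlat_iff _).2 ⟨Z, hZ, rfl⟩)

/-- Two covectors that vanish on `F` and are opposite and nonzero at one element of a flat `G`
covering `F` are opposite wherever the first is nonzero on `G`. -/
lemma elim_of_covers (hG : O.underlying.IsFlat G)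
    (hFG : ∀ H, O.underlying.IsFlat H → F ⊆ H → H ⊆ G → H = F ∨ H = G) (hF : F ⊆ G)
    (hX : X ∈ O.covectors) (hY : Y ∈ O.covectors) (hXF : ∀ i ∈ F, X i = 0)
    (hYF : ∀ i ∈ F, Y i = 0) {i j : α} (hi : i ∈ G) (hj : j ∈ G) (hXj : X j ≠ 0)
    (hXYj : X j = -Y j) (hXi : X i ≠ 0) : X i = -Y i := by
  by_contra hne
  obtain ⟨Z, hZ, hZj, hZe⟩ := O.elim X hX Y hY j hXj hXYj
  have hZi : Z i = X i := by rw [hZe i fun h => hne h.2, if_pos hXi]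
  have hZF : ∀ k ∈ F, Z k = 0 := fun k hk => by
    rw [hZe k fun h => h.1 (hXF k hk), if_neg (by simp [hXF k hk]), hYF k hk]
  rcases hFG _ (isFlat_inter_zeros hG hZ) (fun k hk => ⟨hF hk, hZF k hk⟩) inter_subset_left
    with h | h
  · exact hXj (hXF j (h ▸ ⟨hj, hZj⟩))
  · exact hXi (hZi ▸ (h.ge hi).2)

/-- Since `∅` is a flat, some covector vanishes nowhere; composing a tope with it fills in any
zeros. -/
lemma mem_topes_iff [O.underlying.Loopless] :
    T ∈ O.topes ↔ T ∈ O.covectors ∧ ∀ i, T i ≠ 0 := by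
  constructor
  · rintro ⟨hT, hmax⟩
    refine ⟨hT, fun i hi => ?_⟩
    obtain ⟨X, hX, hX0⟩ := (O.underlying_isFlat_iff ∅).1 Matroid.isFlat_empty
    have := congrFun (hmax _ (O.comp_mem T hT X hX) fun i => by
      by_cases h : T i = 0 <;> simp [h]) i
    rw [if_neg (by simp [hi]), hi] at this
    have h' : i ∈ ({i | X i = 0} : Set α) := this
    rw [← hX0] at h'
    exact h'
  · rintro ⟨hT, h0⟩
    exact ⟨hT, fun Y _ h => funext fun i => ((h i).resolve_left (h0 i)).symm⟩

/-- Adjoining `∅` and `univ` costs nothing, as they give `T` and `0`. It lets the first and last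
gaps of a flag be treated like the others. -/
lemma mem_adjacentTopes_iff [O.underlying.Loopless] :
    T ∈ O.adjacentTopes c ↔ (∀ i, T i ≠ 0) ∧ T ∈ O.covectors ∧
      ∀ F ∈ insert ∅ (insert univ c), Fᶜ.indicator T ∈ O.covectors := by
  simp only [adjacentTopes, mem_ofPred_eq, mem_topes_iff, forall_mem_insert]
  simp only [compl_empty, indicator_univ, compl_univ, indicator_empty]
  have := O.zero_mem
  change (0 : α → SignType) ∈ _ at this
  constructor
  · rintro ⟨⟨h1, h2⟩, h3⟩
    exact ⟨h2, h1, h1, this, h3⟩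
  · rintro ⟨h2, h1, -, -, h3⟩
    exact ⟨⟨h1, h2⟩, h3⟩

/-- Every chain of flats has an adjacent tope. -/
lemma exists_mem_adjacentTopes [O.underlying.Loopless] (hchain : IsChain (· ⊆ ·) c)
    (hflat : ∀ F ∈ c, O.underlying.IsFlat F) : (O.adjacentTopes c).Nonempty := by
  induction c using WellFoundedLT.induction with
  | ind c ih =>
  rcases c.eq_empty_or_nonempty with rfl | hne
  · obtain ⟨X, hX, hX0⟩ := (O.underlying_isFlat_iff ∅).1 Matroid.isFlat_empty
    refine ⟨X, mem_topes_iff.2 ⟨hX, fun i hi => ?_⟩, by simp⟩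
    have h' : i ∈ ({i | X i = 0} : Set α) := hi
    rw [← hX0] at h'
    exact h'
  · obtain ⟨G, hG, hGmax⟩ := (toFinite c).exists_maximal hne
    -- With `X` a covector whose zero set is the largest member `G`, the composition of `X` with `T`
    -- is the required tope: cutting at `G` leaves `X`, and cutting at a smaller `F` leaves `X`
    -- composed with `T` cut at `F`.
    obtain ⟨T, hT⟩ := ih (c \ {G}) ⟨sdiff_subset, fun h => (h hG).2 rfl⟩
      (hchain.mono sdiff_subset) (fun F hF => hflat F hF.1)
    obtain ⟨h0, hTc, hTF⟩ := mem_adjacentTopes_iff.1 hT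
    obtain ⟨X, hX, rfl⟩ := (O.underlying_isFlat_iff G).1 (hflat G hG)
    refine ⟨_, mem_topes_iff.2 ⟨O.comp_mem X hX T hTc, fun i => ?_⟩, fun F hF => ?_⟩
    · by_cases h : X i = 0 <;> simp [h, h0]
    · by_cases hFG : F = {i | X i = 0}
      · convert hX using 1
        ext1 i
        by_cases h : X i = 0 <;> simp [hFG, h]
      · have hsub : F ⊆ {i | X i = 0} := by
          rcases hchain.total hF hG with h | h
          exacts [h, hGmax hF h]
        convert O.comp_mem X hX _
          (hTF F (mem_insert_of_mem _ (mem_insert_of_mem _ ⟨hF, hFG⟩))) using 1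
        ext1 i
        by_cases hi : i ∈ F
        · have : X i = 0 := hsub hi
          simp [hi, this]
        · simp [hi]

/-- Flipping the signs on a member of the flag preserves adjacency. -/
lemma flip_mem_adjacentTopes [O.underlying.Loopless] (hc : IsChain (· ⊆ ·) (insert univ c))
    (hF : F ∈ insert univ c) (hT : T ∈ O.adjacentTopes c) {T' : α → SignType}
    (h1 : ∀ i ∈ F, T' i = -T i) (h2 : ∀ i ∉ F, T' i = T i) : T' ∈ O.adjacentTopes c := by
  rw [mem_adjacentTopes_iff] at hT
  obtain ⟨h0, hTc, hTF⟩ := hT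
  have hchain : IsChain (· ⊆ ·) (insert ∅ (insert univ c)) :=
    hc.insert fun _ _ _ => Or.inl (empty_subset _)
  have hF' := mem_insert_of_mem ∅ hF
  have key : ∀ K ∈ insert ∅ (insert univ c), Kᶜ.indicator T' ∈ O.covectors := by
    intro K hK
    rcases hchain.total hF' hK with h | h
    -- If `F ⊆ K`, the flip is invisible off `K`. If `K ⊆ F`, the cut of `T'` at `K` is the cut of
    -- `T` at `F` composed with the negative of its cut at `K`.
    · convert hTF K hK using 1
      refine indicator_congr fun i hi => h2 i fun hiF => hi (h hiF)
    · convert O.comp_mem _ (hTF F hF') _ (O.neg_mem _ (hTF K hK)) using 1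
      ext1 i
      by_cases hi : i ∈ F
      · by_cases hiK : i ∈ K <;> simp [hi, hiK, h1]
      · have : i ∉ K := fun hiK => hi (h hiK)
        simp [hi, this, h2, h0]
  refine mem_adjacentTopes_iff.2 ⟨fun i => ?_, ?_, key⟩
  · by_cases hi : i ∈ F
    · simpa [h1 i hi] using h0 i
    · simpa [h2 i hi] using h0 i
  · simpa using key ∅ (mem_insert _ _)

/-- Let `F ⊂ H₀ ⊂ G` be flats such that all flats strictly between `F` and `G` cover `F` and are
covered by `G`. If setting the coordinates of a tope `T` in `F`, `H₀` or `G` to zero gives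
covectors, then the same holds for exactly one further flat strictly between `F` and `G`. -/
lemma exists_opposite {H₀ : Set α} (hG : O.underlying.IsFlat G)
    (hgap : ∀ H H', O.underlying.IsFlat H → O.underlying.IsFlat H' → F ⊂ H → H ⊆ H' → H' ⊂ G →
      H = H')
    (hH₀ : O.underlying.IsFlat H₀) (hF₀ : F ⊂ H₀) (hG₀ : H₀ ⊂ G) (hT : ∀ i, T i ≠ 0)
    (hTF : Fᶜ.indicator T ∈ O.covectors) (hTG : Gᶜ.indicator T ∈ O.covectors)
    (hT₀ : H₀ᶜ.indicator T ∈ O.covectors) :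
    ∃ H₁, O.underlying.IsFlat H₁ ∧ F ⊂ H₁ ∧ H₁ ⊂ G ∧ H₁ ≠ H₀ ∧ H₁ᶜ.indicator T ∈ O.covectors ∧
      ∀ H₂, O.underlying.IsFlat H₂ → F ⊂ H₂ → H₂ ⊂ G → H₂ᶜ.indicator T ∈ O.covectors →
        H₂ = H₀ ∨ H₂ = H₁ := by
  have hnn : ∀ s : SignType, s ≠ 0 → s ≠ -s := by decide
  obtain ⟨e, heH, heF⟩ := exists_of_ssubset hF₀
  have hgap' : ∀ H H', O.underlying.IsFlat H → O.underlying.IsFlat H' → F ⊂ H → H ⊂ G → F ⊂ H' →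
      H' ⊂ G → ∀ x ∈ H, x ∈ H' → x ∉ F → H = H' := by
    intro H H' hH hH' h1 h2 h3 h4 x hx hx' hxF
    have hFI : F ⊂ H ∩ H' := ⟨subset_inter h1.subset h3.subset, fun h => hxF (h ⟨hx, hx'⟩)⟩
    exact (hgap _ _ (hH.inter hH') hH hFI inter_subset_left h2).symm.trans
      (hgap _ _ (hH.inter hH') hH' hFI inter_subset_right h4)
  obtain ⟨H₁, hH₁, hF₁, hG₁, hne, hT₁⟩ : ∃ H₁, O.underlying.IsFlat H₁ ∧ F ⊂ H₁ ∧ H₁ ⊂ G ∧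
      H₁ ≠ H₀ ∧ H₁ᶜ.indicator T ∈ O.covectors := by
    obtain ⟨f, hfG, hfH⟩ := exists_of_ssubset hG₀
    have hfF : f ∉ F := fun h => hfH (hF₀.subset h)
    -- Candidates for the second endpoint of the arc: they agree with `T` at `e ∈ H₀`, which
    -- excludes `H₀` as their zero set in `G`, but have a further zero in `G \ F`.
    let P : Set (α → SignType) := {Z | Z ∈ O.covectors ∧ (∀ i ∈ F, Z i = 0) ∧ Z e = T e ∧
      ∃ f ∈ G, f ∉ F ∧ Z f = 0}
    have hP : P.Nonempty := by
      -- The second covector is the reflection of `T` through the endpoint `H₀`: it equals `T` on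
      -- `H₀ \ F` and `-T` off `H₀`.
      obtain ⟨Z, hZ, hZf, hZe⟩ := O.elim _ hTF _ (O.comp_mem _ (O.neg_mem _ hT₀) _ hTF) f
        (by simpa [hfF] using hT f) (by simp [hfF, hfH, hT])
      refine ⟨Z, hZ, fun i hi => ?_, ?_, f, hfG, hfF, hZf⟩
      · rw [hZe i (by simp [hi])]
        simp [hi, hF₀.subset hi]
      · rw [hZe e (by simp [heF, heH])]
        simp [heF, hT]
    obtain ⟨N, hN⟩ := (toFinite ((fun Z : α → SignType => {j ∈ G | Z j = -T j}) '' P)).exists_minimal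
      (hP.image _)
    obtain ⟨⟨Z, ⟨hZ, hZF, hZe, f, hfG, hfF, hZf⟩, rfl⟩, hmin⟩ := hN
    -- A candidate with the fewest disagreements with `T` on `G` has none: eliminating a
    -- disagreement `g` against `T` cut at `F` gives another candidate, with no new disagreement and
    -- with value `0` at `g`.
    have hpos : ∀ g ∈ G, Z g ≠ -T g := by
      intro g hg hZg
      have hgF : g ∉ F := fun h => hT g (by simpa [hZF g h] using hZg.symm)
      obtain ⟨W, hW, hWg, hWe⟩ := O.elim Z hZ _ hTF g (by simpa [hZg] using hT g)
        (by simpa [hgF] using hZg)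
      have hWP : W ∈ P := by
        refine ⟨hW, fun i hi => ?_, ?_, g, hg, hgF, hWg⟩
        · rw [hWe i (by simp [hZF i hi])]
          simp [hZF i hi, hi]
        · rw [hWe e (by simp [hZe, heF])]
          simp [hZe, hT]
      have hle : {j ∈ G | W j = -T j} ≤ {j ∈ G | Z j = -T j} := by
        rintro j ⟨hj, hWj⟩
        refine ⟨hj, ?_⟩
        by_contra hZj
        have hjF : j ∉ F := fun h => hT j (by simpa [hWP.2.1 j h] using hWj.symm)
        have := hWe j (by simpa [hjF] using fun _ => hZj)
        by_cases hz : Z j = 0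
        · rw [if_neg (by simp [hz]), hWj] at this
          simp only [indicator_of_mem (show j ∈ Fᶜ from hjF)] at this
          exact hnn _ (hT j) this.symm
        · rw [if_pos hz, hWj] at this
          exact hZj this.symm
      have := (hmin ⟨W, hWP, rfl⟩ hle ⟨hg, hZg⟩ : g ∈ {j ∈ G | W j = -T j}).2
      rw [hWg] at this
      exact hT g (by simpa using this.symm)
    have hval : ∀ g ∈ G, Z g ≠ 0 → Z g = T g := fun g hg hz =>
      (show ∀ a b : SignType, b ≠ 0 → a ≠ -b → a ≠ 0 → a = b by decide) _ _ (hT g) (hpos g hg) hz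
    have heG := hG₀.subset heH
    -- Now `Z` is `0` or `T` throughout `G`, so `T` cut at `G` composed with `Z` is `T` cut at this
    -- flat.
    refine ⟨G ∩ {i | Z i = 0}, isFlat_inter_zeros hG hZ,
      ⟨fun i hi => ⟨hG₀.subset (hF₀.subset hi), hZF i hi⟩, fun h => hfF (h ⟨hfG, hZf⟩)⟩,
      ⟨inter_subset_left, fun h => hT e (hZe ▸ (h heG).2)⟩,
      fun h => hT e (hZe ▸ (h.ge heH).2), ?_⟩
    convert O.comp_mem _ hTG _ hZ using 1
    ext1 i
    by_cases hi : i ∈ G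
    · by_cases hz : Z i = 0
      · simp [hi, hz]
      · simp [hi, hval i hi hz]
    · simp [hi, hT]
  refine ⟨H₁, hH₁, hF₁, hG₁, hne, hT₁, fun H₂ hH₂ hF₂ hG₂ hT₂ => ?_⟩
  by_contra! hcon
  obtain ⟨p, hp, hpF⟩ := exists_of_ssubset hF₁
  obtain ⟨q, hq, hqF⟩ := exists_of_ssubset hF₂
  have he1 : e ∉ H₁ := fun h => hne (hgap' _ _ hH₁ hH₀ hF₁ hG₁ hF₀ hG₀ e h heH heF)
  have he2 : e ∉ H₂ := fun h => hcon.1 (hgap' _ _ hH₂ hH₀ hF₂ hG₂ hF₀ hG₀ e h heH heF)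
  have hp2 : p ∉ H₂ := fun h => hcon.2 (hgap' _ _ hH₂ hH₁ hF₂ hG₂ hF₁ hG₁ p h hp hpF)
  have hp0 : p ∉ H₀ := fun h => hne (hgap' _ _ hH₁ hH₀ hF₁ hG₁ hF₀ hG₀ p hp h hpF)
  have hq1 : q ∉ H₁ := fun h => hcon.2 (hgap' _ _ hH₂ hH₁ hF₂ hG₂ hF₁ hG₁ q hq h hqF)
  have hq0 : q ∉ H₀ := fun h => hcon.1 (hgap' _ _ hH₂ hH₀ hF₂ hG₂ hF₀ hG₀ q hq h hqF)
  -- Suppose there were three endpoints. This `Z` vanishes on `H₀`, yet is `-T` at `p ∈ H₁` and `T`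
  -- at `q ∈ H₂`. As `G` covers `H₀`, `elim_of_covers` forces `Z` and `T` to be opposite at `q` as
  -- well as at `p`.
  obtain ⟨Z, hZ, hZe, hZc⟩ := O.elim _ hT₁ _ (O.neg_mem _ hT₂) e
    (by simpa [he1] using hT e) (by simp [he1, he2])
  have hZp : Z p = -T p := by rw [hZc p (by simp [hp])]; simp [hp, hp2]
  have hZq : Z q = T q := by rw [hZc q (by simp [hq])]; simp [hq1, hT]
  have hZF : ∀ i ∈ F, Z i = 0 := fun i hi => by
    have h1 := hF₁.subset hi
    have h2 := hF₂.subset hi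
    rw [hZc i (by simp [h1])]; simp [h1, h2]
  have hpG := hG₁.subset hp
  have hqG := hG₂.subset hq
  have hH : H₀ = G ∩ {i | Z i = 0} := by
    refine hgap' _ _ hH₀ (isFlat_inter_zeros hG hZ) hF₀ hG₀
      ⟨fun i hi => ⟨hG₀.subset (hF₀.subset hi), hZF i hi⟩, fun h => heF (h ⟨hG₀.subset heH, hZe⟩)⟩
      ⟨inter_subset_left, fun h => hT q (hZq ▸ (h hqG).2)⟩ e heH ⟨hG₀.subset heH, hZe⟩ heF
  have := elim_of_covers hG (F := H₀) (fun K hK h1 h2 => ?_) hG₀.subset hT₀ hZ (by simp +contextual)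
    (fun i hi => (hH.le hi).2) hqG hpG (by simpa [hp0] using hT p)
    (by simp [hp0, hZp]) (by simpa [hq0] using hT q)
  · simp only [hZq, indicator_of_mem (show q ∈ H₀ᶜ from hq0)] at this
    exact hnn _ (hT q) this
  · by_cases hKG : K = G
    · exact Or.inr hKG
    · exact Or.inl (hgap _ _ hH₀ hK hF₀ h1 (h2.ssubset_of_ne hKG)).symm

/-! ### Phases of flags -/

lemma phase_nonempty [O.underlying.Loopless] (hc : O.underlying.IsFlag c) :
    (O.phase c).Nonempty := by
  obtain ⟨T, hT⟩ := O.exists_mem_adjacentTopes hc.2 fun F hF => (hc.1 F hF).1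
  obtain ⟨ε, rfl⟩ := exists_signVector_eq (mem_adjacentTopes_iff.1 hT).1
  exact ⟨ε, hT⟩

lemma add_indicator_mem_phase [O.underlying.Loopless] (hc : O.underlying.IsFlag c)
    (hF : F ∈ O.underlying.extendedFlag c) {ε : α → ZMod 2} (hε : ε ∈ O.phase c) :
    ε + F.indicator 1 ∈ O.phase c := by
  have hs : ∀ a : ZMod 2, (-1 : SignType) ^ (a + 1).val = -(-1) ^ a.val := by decide
  refine flip_mem_adjacentTopes (F := F)
    (hc.2.insert fun K _ _ => Or.inr (subset_univ K)) hF.1 hε (fun i hi => ?_) fun i hi => ?_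
  · simp [signVector, hi, hs]
  · simp [signVector, hi]

lemma sub_eq_of_mem_phase [O.underlying.Loopless] (hc : O.underlying.IsMaximalFlag c)
    {ε ε' : α → ZMod 2} (hε : ε ∈ O.phase c) (hε' : ε' ∈ O.phase c) {i j : α}
    (hij : ∀ F ∈ O.underlying.extendedFlag c, i ∈ F ↔ j ∈ F) :
    ε i - ε' i = ε j - ε' j := by
  obtain ⟨F, hF, G, hG, hiF, hiG, hFG, hgap⟩ := hc.exists_gap (mem_univ i)
  have hjF : j ∉ F := by
    rcases hF with rfl | hF
    exacts [notMem_empty _, fun h => hiF ((hij F hF).2 h)]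
  have hF' : F ∈ insert ∅ (insert univ c) := by
    rcases hF with rfl | hF
    exacts [mem_insert _ _, mem_insert_of_mem _ hF.1]
  have hX := (mem_adjacentTopes_iff.1 hε).2.2 F hF'
  have hY := (mem_adjacentTopes_iff.1 hε').2.2 F hF'
  have hGf := hc.prop.isFlat hG
  have hjG := (hij G hG).1 hiG
  have h0 : ∀ k, signVector ε k ≠ 0 := (mem_adjacentTopes_iff.1 hε).1
  have h1 := elim_of_covers hGf hgap hFG hX hY (by simp +contextual) (by simp +contextual)
    hiG hjG (by simpa [hjF] using h0 j)
  have h2 := elim_of_covers hGf hgap hFG hX hY (by simp +contextual) (by simp +contextual)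
    hjG hiG (by simpa [hiF] using h0 i)
  simp only [indicator_of_mem (show i ∈ Fᶜ from hiF), indicator_of_mem (show j ∈ Fᶜ from hjF),
    signVector] at h1 h2
  -- Together `h1` and `h2` say that the two sign vectors are opposite at `i` exactly when they are
  -- at `j`.
  have hs : ∀ a a' b b' : ZMod 2,
      ((-1 : SignType) ^ b.val = -(-1) ^ b'.val → (-1 : SignType) ^ a.val ≠ 0 →
        (-1 : SignType) ^ a.val = -(-1) ^ a'.val) →
      ((-1 : SignType) ^ a.val = -(-1) ^ a'.val → (-1 : SignType) ^ b.val ≠ 0 →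
        (-1 : SignType) ^ b.val = -(-1) ^ b'.val) → a - a' = b - b' := by decide
  exact hs _ _ _ _ h1 h2

/-- Given a maximal flag `c₀` and a flag `c` obtained from it by removing a flat, every `ε` in the
phase of `c₀` lies in the phase of exactly one further maximal flag containing `c`. -/
lemma exists_opposite_flag [O.underlying.Loopless] {c₀ : Set (Set α)} (hcc : c ⊆ c₀)
    (hc₀ : O.underlying.IsMaximalFlag c₀)
    (hcard : (O.underlying.extendedFlag c).ncard + 1 = O.underlying.natRk O.underlying.E)
    {ε : α → ZMod 2} (hε : ε ∈ O.phase c₀) :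
    ∃ c₁, c ⊆ c₁ ∧ c₁ ≠ c₀ ∧ O.underlying.IsMaximalFlag c₁ ∧ ε ∈ O.phase c₁ ∧
      ∀ c₂, c ⊆ c₂ → O.underlying.IsMaximalFlag c₂ → ε ∈ O.phase c₂ → c₂ = c₀ ∨ c₂ = c₁ := by
  set N := O.underlying with hN
  obtain ⟨H₀, hH₀c, hH₀, he₀⟩ := hc₀.exists_extendedFlag_eq_insert hcc hcard
  have hsub : N.extendedFlag c ⊆ N.extendedFlag c₀ := Matroid.extendedFlag_mono hcc
  have hH₀' := hc₀.prop.mem_extendedFlag hH₀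
  have hH₀f := hc₀.prop.isFlat hH₀'
  have hpos : 0 < N.natRk H₀ := Matroid.natRk_pos hH₀f.subset_ground hH₀'.2
  have hlt : N.natRk H₀ < N.natRk N.E := hH₀f.natRk_lt N.ground_isFlat
    (hH₀f.subset_ground.ssubset_of_ne (hc₀.prop.1 H₀ hH₀).2.2)
  have huniq : ∀ K ∈ N.extendedFlag c₀, N.natRk K = N.natRk H₀ → K = H₀ := fun K hK h =>
    hc₀.prop.natRk_injOn hK hH₀' h
  have hmem : ∀ K ∈ insert ∅ (N.extendedFlag c₀), N.natRk K ≠ N.natRk H₀ →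
      K ∈ insert ∅ (N.extendedFlag c) := by
    rintro K (rfl | hK) hne
    · exact mem_insert _ _
    · rw [he₀] at hK
      exact mem_insert_of_mem _ (hK.resolve_left fun h => hne (h ▸ rfl))
  -- The neighbours of the removed flat `H₀`, possibly `∅` below or the ground set above. Their
  -- ranks differ from that of `H₀`, so they survive in `c` and bound its only interval of rank two.
  obtain ⟨F, hF, hFr⟩ := hc₀.exists_natRk_eq (r := N.natRk H₀ - 1) (by omega)
  obtain ⟨G, hG, hGr⟩ := hc₀.exists_natRk_eq (r := N.natRk H₀ + 1) (by omega)
  replace hF := hmem F hF (by omega)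
  replace hG := (hmem G hG (by omega)).resolve_left
    (by rintro rfl; simp [Matroid.natRk_empty] at hGr)
  have hbetween : ∀ c₂, c ⊆ c₂ → N.IsMaximalFlag c₂ → ∀ H ∈ c₂, N.natRk H = N.natRk H₀ →
      F ⊂ H ∧ H ⊂ G := by
    intro c₂ hcc₂ hc₂ H hH hr
    have hH' := hc₂.prop.mem_extendedFlag hH
    have hsub₂ : N.extendedFlag c ⊆ N.extendedFlag c₂ := Matroid.extendedFlag_mono hcc₂
    constructor
    · refine ssubset_of_subset_of_ne ?_ (by rintro rfl; omega)
      rcases hF with rfl | hF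
      · exact empty_subset _
      · exact hc₂.prop.subset_of_natRk_le (hsub₂ hF) hH' (by omega)
    · exact (hc₂.prop.subset_of_natRk_le hH' (hsub₂ hG) (by omega)).ssubset_of_ne
        (by rintro rfl; omega)
  obtain ⟨hF₀, hG₀⟩ := hbetween c₀ hcc hc₀ H₀ hH₀ rfl
  have hFf : N.IsFlat F := by
    rcases hF with rfl | hF
    exacts [Matroid.isFlat_empty, hc₀.prop.isFlat (hsub hF)]
  have hGf : N.IsFlat G := hc₀.prop.isFlat (hsub hG)
  have hrank : ∀ H, N.IsFlat H → F ⊂ H → H ⊂ G → N.natRk H = N.natRk H₀ := by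
    intro H hH h1 h2
    have := hFf.natRk_lt hH h1
    have := hH.natRk_lt hGf h2
    omega
  obtain ⟨h0, hTc, hTF⟩ := mem_adjacentTopes_iff.1 hε
  have hcov : ∀ K ∈ insert ∅ (N.extendedFlag c₀), Kᶜ.indicator (signVector ε) ∈ O.covectors := by
    rintro K (rfl | hK)
    exacts [hTF _ (mem_insert _ _), hTF K (mem_insert_of_mem _ hK.1)]
  obtain ⟨H₁, hH₁, hF₁, hG₁, hne, hT₁, hex⟩ := exists_opposite hGf
    (fun H H' hH hH' h1 h2 h3 => by
      by_contra hne
      have := hH.natRk_lt hH' (h2.ssubset_of_ne hne)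
      rw [hrank H hH h1 (h2.trans_ssubset h3), hrank H' hH' (h1.trans_subset h2) h3] at this
      exact this.false)
    hH₀f hF₀ hG₀ h0 (hcov F (insert_subset_insert hsub hF))
    (hcov G (mem_insert_of_mem _ (hsub hG))) (hcov H₀ (mem_insert_of_mem _ hH₀'))
  have hr₁ := hrank H₁ hH₁ hF₁ hG₁
  have hnot : H₁ ∉ N.extendedFlag c₀ := fun h => hne (huniq _ h hr₁)
  have hne₁ : H₁.Nonempty := nonempty_of_ssubset' hF₁
  have hflag : N.IsFlag (insert H₁ c) := by
    refine ⟨?_, (hc₀.prop.subset hcc).2.insert fun K hK _ => ?_⟩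
    · rintro K (rfl | hK)
      · exact ⟨hH₁, hne₁, (hG₁.trans_subset hGf.subset_ground).ne⟩
      · exact hc₀.prop.1 K (hcc hK)
    · have hK' := (hc₀.prop.subset hcc).mem_extendedFlag hK
      have hKr : N.natRk K ≠ N.natRk H₀ := fun h => hH₀c (huniq K (hsub hK') h ▸ hK')
      rcases hKr.lt_or_gt with h | h
      · refine Or.inr (Subset.trans ?_ hF₁.subset)
        rcases hF with rfl | hF
        · have := Matroid.natRk_pos (hc₀.prop.isFlat (hsub hK')).subset_ground hK'.2
          rw [Matroid.natRk_empty] at hFr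
          omega
        · exact hc₀.prop.subset_of_natRk_le (hsub hK') (hsub hF) (by omega)
      · exact Or.inl (hG₁.subset.trans
          (hc₀.prop.subset_of_natRk_le (hsub hG) (hsub hK') (by omega)))
  have he₁ : N.extendedFlag (insert H₁ c) = insert H₁ (N.extendedFlag c) :=
    Matroid.extendedFlag_insert hne₁
  refine ⟨insert H₁ c, subset_insert _ _, ?_, hflag.isMaximalFlag ?_, ?_, ?_⟩
  · rintro rfl
    exact hnot (hflag.mem_extendedFlag (mem_insert _ _))
  · rw [he₁, ncard_insert_of_notMem (fun h => hnot (hsub h)), hcard]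
  · refine ⟨hε.1, ?_⟩
    rintro K (rfl | hK)
    exacts [hT₁, hε.2 K (hcc hK)]
  · intro c₂ hcc₂ hc₂ hε₂
    obtain ⟨H₂, hH₂c, hH₂, he₂⟩ := hc₂.exists_extendedFlag_eq_insert hcc₂ hcard
    -- Every maximal flag realises each rank once, so the flat completing `c` always has the same
    -- missing rank.
    have hr₂ : N.natRk H₂ = N.natRk H₀ := by
      have himg := hc₂.image_natRk.trans hc₀.image_natRk.symm
      have : N.natRk H₂ ∈ N.natRk '' N.extendedFlag c₀ :=
        himg ▸ mem_image_of_mem _ (hc₂.prop.mem_extendedFlag hH₂)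
      rw [he₀, image_insert_eq] at this
      refine this.resolve_right ?_
      rintro ⟨K, hK, hKr⟩
      refine hH₂c (hc₂.prop.natRk_injOn (Matroid.extendedFlag_mono hcc₂ hK)
        (hc₂.prop.mem_extendedFlag hH₂) hKr ▸ hK)
    obtain ⟨hF₂, hG₂⟩ := hbetween c₂ hcc₂ hc₂ H₂ hH₂ hr₂
    rcases hex H₂ (hc₂.prop.1 H₂ hH₂).1 hF₂ hG₂ (hε₂.2 H₂ hH₂) with rfl | rfl
    · have := he₂.trans he₀.symm
      exact Or.inl ((hc₂.prop.subset_of_extendedFlag_subset this.le).antisymm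
        (hc₀.prop.subset_of_extendedFlag_subset this.ge))
    · have := he₂.trans he₁.symm
      exact Or.inr ((hc₂.prop.subset_of_extendedFlag_subset this.le).antisymm
        (hflag.subset_of_extendedFlag_subset this.ge))

end OrientedMatroid

/-! ### Indicator functions of a chain of sets -/

section Indicator

variable {α : Type*} {C : Set (Set α)}

/-- The span of the indicator functions of a chain consists of the functions that vanish outside
of the chain and are constant on the successive differences. -/
lemma mem_span_indicator [Finite α] {R : Type*} [CommRing R] (hC : IsChain (· ⊆ ·) C) {x : α → R}
    (hx : ∀ i j, (∀ F ∈ C, i ∈ F ↔ j ∈ F) → x i = x j)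
    (hx0 : ∀ i, (∀ F ∈ C, i ∉ F) → x i = 0) :
    x ∈ Submodule.span R ((fun F : Set α => F.indicator (1 : α → R)) '' C) := by
  induction C using WellFoundedLT.induction generalizing x with
  | ind C ih =>
  rcases C.eq_empty_or_nonempty with rfl | hne
  · convert Submodule.zero_mem _
    ext i
    simpa using hx0 i
  obtain ⟨G, hG, hGmax⟩ := (toFinite C).exists_maximal hne
  have hsub : ∀ F ∈ C, F ⊆ G := fun F hF => by
    rcases hC.total hF hG with h | h
    exacts [h, hGmax hF h]
  -- The value of `x` on the outermost step of the chain, `0` by default if that step is empty.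
  -- Subtracting `a` times the indicator of `G` leaves a function supported on the smaller members.
  obtain ⟨a, ha⟩ : ∃ a, ∀ i ∈ G, (∀ F ∈ C \ {G}, i ∉ F) → x i = a := by
    by_cases h : ∃ i ∈ G, ∀ F ∈ C \ {G}, i ∉ F
    · obtain ⟨i, hi, hiF⟩ := h
      refine ⟨x i, fun j hj hjF => hx _ _ fun F hF => ?_⟩
      by_cases hFG : F = G
      · simp [hFG, hi, hj]
      · simp [hiF F ⟨hF, hFG⟩, hjF F ⟨hF, hFG⟩]
    · push Not at h
      refine ⟨0, fun i hi hiF => ?_⟩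
      obtain ⟨F, hF, hF'⟩ := h i hi
      exact absurd hF' (hiF F hF)
  have hsupp : ∀ i ∉ G, x i = 0 := fun i hi => hx0 i fun F hF h => hi (hsub F hF h)
  have hzero : ∀ i, (∀ F ∈ C \ {G}, i ∉ F) → (x - a • G.indicator (1 : α → R)) i = 0 := by
    intro i hi
    by_cases hiG : i ∈ G
    · simp [hiG, ha i hiG hi]
    · simp [hiG, hsupp i hiG]
  have key : x - a • G.indicator (1 : α → R) ∈
      Submodule.span R ((fun F : Set α => F.indicator (1 : α → R)) '' (C \ {G})) := by
    refine ih (C \ {G}) ⟨sdiff_subset, fun h => (h hG).2 rfl⟩ (hC.mono sdiff_subset) ?_ hzero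
    intro i j hij
    by_cases h : ∃ F ∈ C \ {G}, i ∈ F
    · obtain ⟨F, hF, hiF⟩ := h
      have hiG := hsub F hF.1 hiF
      have hjG := hsub F hF.1 ((hij F hF).1 hiF)
      have : x i = x j := hx i j fun K hK => by
        by_cases hKG : K = G
        · simp [hKG, hiG, hjG]
        · exact hij K ⟨hK, hKG⟩
      simp [hiG, hjG, this]
    · push Not at h
      rw [hzero i h, hzero j fun F hF hj => h F hF ((hij F hF).2 hj)]
  have h1 := Submodule.span_mono (image_mono sdiff_subset) key
  have h2 := Submodule.smul_mem _ a (Submodule.subset_span (R := R)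
    (mem_image_of_mem (fun F : Set α => F.indicator (1 : α → R)) hG))
  simpa using Submodule.add_mem _ h1 h2

lemma eq_of_mem_span_indicator {R : Type*} [CommRing R] {x : α → R}
    (hx : x ∈ Submodule.span R ((fun F : Set α => F.indicator (1 : α → R)) '' C)) {i j : α}
    (hij : ∀ F ∈ C, i ∈ F ↔ j ∈ F) : x i = x j := by
  induction hx using Submodule.span_induction with
  | mem x hx =>
    obtain ⟨F, hF, rfl⟩ := hx
    have := hij F hF
    by_cases hi : i ∈ F
    · simp [hi, this.1 hi]
    · simp [hi, show j ∉ F from fun h => hi (this.2 h)]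
  | zero => rfl
  | add x y _ _ hx hy => simp [hx, hy]
  | smul a x _ hx => simp [hx]

/-- A nonempty member of a chain has an element outside of all smaller members. -/
lemma exists_mem_forall_subset [Finite α] (hC : IsChain (· ⊆ ·) C) {F : Set α} (hF : F ∈ C)
    (hne : F.Nonempty) : ∃ i ∈ F, ∀ G ∈ C, i ∈ G → F ⊆ G := by
  rcases {G ∈ C | G ⊂ F}.eq_empty_or_nonempty with h | h
  · obtain ⟨i, hi⟩ := hne
    refine ⟨i, hi, fun G hG _ => ?_⟩
    by_contra hcon
    have : G ∈ {G ∈ C | G ⊂ F} := ⟨hG, (hC.total hG hF).resolve_right hcon, hcon⟩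
    rw [h] at this
    exact this
  · obtain ⟨K, ⟨hK, hKF⟩, hKmax⟩ := (toFinite {G ∈ C | G ⊂ F}).exists_maximal h
    obtain ⟨i, hi, hiK⟩ := exists_of_ssubset hKF
    refine ⟨i, hi, fun G hG hiG => ?_⟩
    by_contra hcon
    have hGF : G ⊂ F := ⟨(hC.total hG hF).resolve_right hcon, hcon⟩
    rcases hC.total hG hK with h | h
    exacts [hiK (h hiG), hiK (hKmax ⟨hG, hGF⟩ h hiG)]

/-- Triangularity: at an element of `F` outside all smaller members, only `F` and larger members
contribute, and the larger coefficients already vanish. -/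
lemma linearIndependent_indicator [Finite α] {K : Type*} [Field K] (hC : IsChain (· ⊆ ·) C)
    (hne : ∀ F ∈ C, F.Nonempty) :
    LinearIndependent K fun F : C => (F : Set α).indicator (1 : α → K) := by
  have := Fintype.ofFinite C
  rw [Fintype.linearIndependent_iff]
  intro g hg F
  induction F using WellFoundedGT.induction with
  | ind F ih =>
  obtain ⟨i, hi, hmin⟩ := exists_mem_forall_subset hC F.2 (hne F F.2)
  have := congrFun hg i
  rw [Finset.sum_apply, Finset.sum_eq_single F] at this
  · simpa [hi] using this
  · intro G _ hGF
    by_cases hiG : i ∈ (G : Set α)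
    · have : F < G := lt_of_le_of_ne (hmin G G.2 hiG) (Ne.symm hGF)
      simp [ih G this]
    · simp [hiG]
  · simp

lemma finrank_span_indicator [Finite α] {K : Type*} [Field K] (hC : IsChain (· ⊆ ·) C)
    (hne : ∀ F ∈ C, F.Nonempty) :
    Module.finrank K (Submodule.span K ((fun F : Set α => F.indicator (1 : α → K)) '' C)) =
      C.ncard := by
  have := Fintype.ofFinite C
  rw [image_eq_range, finrank_span_eq_card (linearIndependent_indicator hC hne),
    ← Nat.card_eq_fintype_card]
  rfl

end Indicator

/-! ### Cones of flags -/

/-- `F` is a lower cut of `x`: all values of `x` on `F` are smaller than those outside of `F`. -/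
def IsCut {α : Type*} (x : α → ℝ) (F : Set α) : Prop := ∀ i ∈ F, ∀ j ∉ F, x i < x j

/-- The lower cuts of `x` other than `∅` and the whole set. -/
def properCuts {α : Type*} (x : α → ℝ) : Set (Set α) :=
  {F | IsCut x F ∧ F.Nonempty ∧ F ≠ univ}

namespace Matroid

variable {α : Type*}

lemma flatVector_of_mem {F : Set α} {i : α} (h : i ∈ F) : flatVector F i = -1 := by
  simp [flatVector, h]

lemma flatVector_of_notMem {F : Set α} {i : α} (h : i ∉ F) : flatVector F i = 0 := by
  simp [flatVector, h]

/-- Take `δ` to be the jump of `x` across `F`, the minimum off `F` minus the maximum on `F`. Raising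
`x` by `δ` on `F` closes this jump and creates no new cut. -/
lemma exists_eq_add_flatVector [Finite α] {x : α → ℝ} {F : Set α} (hF : F ∈ properCuts x) :
    ∃ δ > (0 : ℝ), ∃ y : α → ℝ, x = δ • flatVector F + y ∧ properCuts y ⊆ properCuts x \ {F} := by
  obtain ⟨hcut, hne, huniv⟩ := hF
  obtain ⟨p, hp, hpmax⟩ := exists_max_image F x (toFinite F) hne
  obtain ⟨q, hq, hqmin⟩ := exists_min_image Fᶜ x (toFinite _) (nonempty_compl.2 huniv)
  have hpq := hcut p hp q hq
  have hyF : ∀ i ∈ F, (x - (x q - x p) • flatVector F) i = x i + (x q - x p) := fun i hi => by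
    simp [flatVector_of_mem hi]; ring
  have hyF' : ∀ i ∉ F, (x - (x q - x p) • flatVector F) i = x i := fun i hi => by
    simp [flatVector_of_notMem hi]
  refine ⟨x q - x p, sub_pos.2 hpq, x - (x q - x p) • flatVector F, by simp, ?_⟩
  rintro G ⟨hG, hGne, hGu⟩
  refine ⟨⟨fun i hi j hj => ?_, hGne, hGu⟩, ?_⟩
  · have h := hG i hi j hj
    by_cases hiF : i ∈ F <;> by_cases hjF : j ∈ F
    · rw [hyF i hiF, hyF j hjF] at h; linarith
    · exact hcut i hiF j hjF
    · rw [hyF' i hiF, hyF j hjF] at h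
      have h1 := hpmax j hjF
      have h2 := hqmin i hiF
      linarith
    · rwa [hyF' i hiF, hyF' j hjF] at h
  · rintro rfl
    have h := hG p hp q hq
    rw [hyF p hp, hyF' q hq] at h
    linarith

lemma mem_hull_properCuts [Finite α] (x : α → ℝ) :
    x ∈ PointedCone.hull ℝ (flatVector '' properCuts x ∪ {flatVector univ, -flatVector univ}) := by
  induction h : properCuts x using WellFoundedLT.induction generalizing x with
  | ind C ih =>
  subst h
  rcases (properCuts x).eq_empty_or_nonempty with h | ⟨F, hF⟩
  -- Without proper cuts `x` is constant, since a sublevel set of a nonconstant function would be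
  -- one. It is then a nonnegative multiple of one of the two lineality generators, according to its
  -- sign.
  · have hconst : ∀ i j, x i ≤ x j := by
      intro i j
      by_contra! hlt
      have : {k | x k ≤ x j} ∈ properCuts x :=
        ⟨fun a ha b hb => lt_of_le_of_lt ha (not_le.1 hb), ⟨j, le_refl (x j)⟩, fun hu =>
          absurd (hu ▸ mem_univ i : i ∈ {k | x k ≤ x j}) (not_le.2 hlt)⟩
      rw [h] at this
      exact this
    rcases isEmpty_or_nonempty α with hα | ⟨⟨i₀⟩⟩
    · rw [Subsingleton.elim x 0]
      exact Submodule.zero_mem _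
    · have hx : x = x i₀ • -flatVector univ := by
        ext i
        simp [flatVector, le_antisymm (hconst i i₀) (hconst i₀ i)]
      rcases le_total 0 (x i₀) with h0 | h0
      · rw [hx]
        exact PointedCone.smul_mem _ h0 (PointedCone.subset_hull (Or.inr (Or.inr rfl)))
      · rw [hx, show x i₀ • -flatVector univ = (-x i₀) • (flatVector univ : α → ℝ) by simp]
        exact PointedCone.smul_mem _ (neg_nonneg.2 h0)
          (PointedCone.subset_hull (Or.inr (Or.inl rfl)))
  · obtain ⟨δ, hδ, y, hxy, hy⟩ := exists_eq_add_flatVector hF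
    have h1 := ih (properCuts y) (hy.trans_ssubset ⟨sdiff_subset, fun h => (h hF).2 rfl⟩) y rfl
    have h2 : y ∈ PointedCone.hull ℝ
        (flatVector '' properCuts x ∪ {flatVector univ, -flatVector univ}) :=
      Submodule.span_mono (union_subset_union_left _ (image_mono (hy.trans sdiff_subset))) h1
    have h3 : δ • flatVector F ∈ PointedCone.hull ℝ
        (flatVector '' properCuts x ∪ {flatVector univ, -flatVector univ}) :=
      PointedCone.smul_mem _ hδ.le (PointedCone.subset_hull (Or.inl ⟨F, hF, rfl⟩))
    have h4 := Submodule.add_mem _ h3 h2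
    rwa [← hxy] at h4

variable {N : Matroid α} {c c' : Set (Set α)} {x : α → ℝ}

lemma le_of_mem_flagCone (hE : N.E = univ) (hx : x ∈ N.flagCone c) {i j : α}
    (hij : ∀ F ∈ c, i ∈ F → j ∈ F) : x j ≤ x i := by
  rw [flagCone, hE] at hx
  induction hx using Submodule.span_induction with
  | mem x hx =>
    rcases hx with ⟨F, hF, rfl⟩ | rfl | rfl
    · by_cases hi : i ∈ F
      · rw [flatVector_of_mem hi, flatVector_of_mem (hij F hF hi)]
      · rw [flatVector_of_notMem hi]
        by_cases hj : j ∈ F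
        · rw [flatVector_of_mem hj]; norm_num
        · rw [flatVector_of_notMem hj]
    · simp [flatVector]
    · simp [flatVector]
  | zero => exact le_rfl
  | add x y _ _ hx hy => exact add_le_add hx hy
  | smul a x _ hx => exact mul_le_mul_of_nonneg_left hx a.2

/-- If `x` is in the cone and `F` is a cut, each pair inside and outside `F` is separated by a
member of `c`. As `c` is a finite chain, its smallest member containing `F` is `F` itself. The
converse is `mem_hull_properCuts`. -/
lemma mem_flagCone_iff [Finite α] (hE : N.E = univ) (hc : IsChain (· ⊆ ·) c) :
    x ∈ N.flagCone c ↔ properCuts x ⊆ c := by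
  constructor
  · rintro hx F ⟨hcut, hne, huniv⟩
    have h1 : ∀ i ∉ F, ∃ K ∈ c, F ⊆ K ∧ i ∉ K := by
      intro i hi
      have h2 : ∀ j ∈ F, ∃ K ∈ c, j ∈ K ∧ i ∉ K := by
        intro j hj
        by_contra! hcon
        exact absurd (le_of_mem_flagCone hE hx hcon) (not_le.2 (hcut j hj i hi))
      obtain ⟨j₀, hj₀⟩ := hne
      obtain ⟨K₀, hK₀, -, hiK₀⟩ := h2 j₀ hj₀
      obtain ⟨K, ⟨hK, hiK⟩, hKmax⟩ := (toFinite {K ∈ c | i ∉ K}).exists_maximal ⟨K₀, hK₀, hiK₀⟩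
      refine ⟨K, hK, fun j hj => ?_, hiK⟩
      obtain ⟨K', hK', hj', hi'⟩ := h2 j hj
      rcases hc.total hK' hK with h | h
      exacts [h hj', hKmax ⟨hK', hi'⟩ h hj']
    obtain ⟨i₀, hi₀⟩ := (ne_univ_iff_exists_notMem F).1 huniv
    obtain ⟨K₀, hK₀, hFK₀, -⟩ := h1 i₀ hi₀
    obtain ⟨K, ⟨hK, hFK⟩, hKmin⟩ := (toFinite {K ∈ c | F ⊆ K}).exists_minimal ⟨K₀, hK₀, hFK₀⟩
    have : K ⊆ F := by
      intro i hiK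
      by_contra hi
      obtain ⟨K', hK', hFK', hi'⟩ := h1 i hi
      rcases hc.total hK hK' with h | h
      exacts [hi' (h hiK), hi' (hKmin ⟨hK', hFK'⟩ h hiK)]
    rwa [← this.antisymm hFK]
  · intro h
    rw [flagCone, hE]
    exact Submodule.span_mono (union_subset_union_left _ (image_mono h)) (mem_hull_properCuts x)

lemma flatVector_mem_flagCone {F : Set α} (hF : F ∈ c) : flatVector F ∈ N.flagCone c :=
  PointedCone.subset_hull (Or.inl ⟨F, hF, rfl⟩)

lemma mem_properCuts_flatVector {F : Set α} (hne : F.Nonempty) (hu : F ≠ univ) :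
    F ∈ properCuts (flatVector F) :=
  ⟨fun i hi j hj => by rw [flatVector_of_mem hi, flatVector_of_notMem hj]; norm_num, hne, hu⟩

lemma flagCone_mono (h : c ⊆ c') : N.flagCone c ≤ N.flagCone c' :=
  Submodule.span_mono (union_subset_union_left _ (image_mono h))

lemma flagCone_le_iff [Finite α] (hE : N.E = univ) (hc : N.IsFlag c) (hc' : N.IsFlag c') :
    N.flagCone c ≤ N.flagCone c' ↔ c ⊆ c' := by
  refine ⟨fun h F hF => ?_, flagCone_mono⟩
  obtain ⟨-, hne, hu⟩ := hc.1 F hF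
  exact (mem_flagCone_iff hE hc'.2).1 (h (flatVector_mem_flagCone hF))
    (mem_properCuts_flatVector hne (hE ▸ hu))

lemma flagCone_inj [Finite α] (hE : N.E = univ) (hc : N.IsFlag c) (hc' : N.IsFlag c')
    (h : N.flagCone c = N.flagCone c') : c = c' :=
  ((flagCone_le_iff hE hc hc').1 h.le).antisymm ((flagCone_le_iff hE hc' hc).1 h.ge)

lemma flagCone_isFaceOf [Finite α] (hE : N.E = univ) (hc' : IsChain (· ⊆ ·) c') (h : c ⊆ c') :
    (N.flagCone c).IsFaceOf (N.flagCone c') where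
  le := flagCone_mono h
  mem_of_smul_add_mem := by
    intro x y a hx hy ha hxy
    rw [mem_flagCone_iff hE (hc'.mono h)] at hxy ⊢
    rintro F hF
    have hFc' := (mem_flagCone_iff hE hc').1 hx hF
    refine hxy ⟨fun i hi j hj => ?_, hF.2⟩
    -- Since `F` belongs to the chain `c'`, `y` cannot decrease across it, so the strict cut `F` of
    -- `x` remains a cut of `a • x + y`.
    have h1 : y i ≤ y j := le_of_mem_flagCone hE hy fun K hK hjK => by
      rcases hc'.total hK hFc' with h | h
      exacts [absurd (h hjK) hj, h hi]
    have h2 := mul_lt_mul_of_pos_left (hF.1 i hi j hj) ha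
    simp only [Pi.add_apply, Pi.smul_apply, smul_eq_mul]
    linarith

lemma flagCone_inf [Finite α] (hE : N.E = univ) (hc : IsChain (· ⊆ ·) c) (hc' : IsChain (· ⊆ ·) c') :
    N.flagCone c ⊓ N.flagCone c' = N.flagCone (c ∩ c') := by
  ext x
  rw [Submodule.mem_inf, mem_flagCone_iff hE hc, mem_flagCone_iff hE hc',
    mem_flagCone_iff hE (hc.mono inter_subset_left), subset_inter_iff]

/-- The faces of the cone of a flag are the cones of the subflags. -/
lemma eq_flagCone_of_isFaceOf [Finite α] (hE : N.E = univ) (hc : IsChain (· ⊆ ·) c)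
    {τ : PointedCone ℝ (α → ℝ)} (hτ : τ.IsFaceOf (N.flagCone c)) :
    τ = N.flagCone {F ∈ c | flatVector F ∈ τ} := by
  refine le_antisymm (fun x hx => ?_) ?_
  · have hcuts := (mem_flagCone_iff hE hc).1 (hτ.le hx)
    rw [mem_flagCone_iff hE (hc.mono (sep_subset _ _))]
    intro F hF
    refine ⟨hcuts hF, ?_⟩
    -- Here `x` is a positive multiple of the generator of `F` plus a vector `y` of the cone, so the
    -- face property puts that generator in `τ`.
    obtain ⟨δ, hδ, y, hxy, hy⟩ := exists_eq_add_flatVector hF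
    refine hτ.mem_of_smul_add_mem (flatVector_mem_flagCone (hcuts hF)) ?_ hδ (hxy ▸ hx)
    exact (mem_flagCone_iff hE hc).2 ((hy.trans sdiff_subset).trans hcuts)
  · have h1 : flatVector N.E ∈ N.flagCone c :=
      PointedCone.subset_hull (Or.inr (Or.inl rfl))
    have h2 : -flatVector N.E ∈ N.flagCone c :=
      PointedCone.subset_hull (Or.inr (Or.inr rfl))
    have h0 : flatVector N.E + -flatVector N.E ∈ τ := by
      rw [add_neg_cancel]; exact Submodule.zero_mem _
    refine Submodule.span_le.2 ?_
    rintro _ (⟨F, hF, rfl⟩ | rfl | rfl)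
    exacts [hF.2, hτ.mem_of_add_mem_left h1 h2 h0, hτ.mem_of_add_mem_right h1 h2 h0]

lemma isFaceOf_flagCone_iff [Finite α] (hE : N.E = univ) (hc : N.IsFlag c) (hc' : N.IsFlag c') :
    (N.flagCone c).IsFaceOf (N.flagCone c') ↔ c ⊆ c' :=
  ⟨fun h => (flagCone_le_iff hE hc hc').1 h.le, flagCone_isFaceOf hE hc'.2⟩

lemma exists_finset_flagCone_eq [Finite α] (N : Matroid α) (c : Set (Set α)) : ∃ S : Finset (α → ℤ),
    N.flagCone c =
      PointedCone.hull ℝ ((fun (z : α → ℤ) (i : α) => (z i : ℝ)) '' (S : Set (α → ℤ))) := by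
  let v : Set α → α → ℤ := fun F => -F.indicator 1
  have hv : ∀ F, (fun i => (v F i : ℝ)) = flatVector F := fun F => by
    ext i
    by_cases h : i ∈ F <;> simp [v, flatVector, h]
  have hv' : (fun i => ((-v N.E) i : ℝ)) = -flatVector N.E := by
    rw [← hv]; ext i; simp
  refine ⟨(toFinite (v '' c ∪ {v N.E, -v N.E})).toFinset, ?_⟩
  rw [Finite.coe_toFinset, image_union, image_image, image_pair, hv']
  simp only [hv]
  rfl

lemma isRationalFan_loopfreeFan [Finite α] (hE : N.E = univ) : IsRationalFan N.loopfreeFan where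
  finite := (toFinite (N.flagCone '' {c | N.IsFlag c})).subset <| by
    rintro _ ⟨c, hc, rfl⟩
    exact ⟨c, hc, rfl⟩
  rational := by
    rintro _ ⟨c, hc, rfl⟩
    exact N.exists_finset_flagCone_eq c
  face_mem := by
    rintro _ ⟨c, hc, rfl⟩ τ hτ
    exact ⟨_, hc.subset (sep_subset _ _), eq_flagCone_of_isFaceOf hE hc.2 hτ⟩
  inf_isFaceOf := by
    rintro _ ⟨c, hc, rfl⟩ _ ⟨c', hc', rfl⟩
    rw [flagCone_inf hE hc.2 hc'.2]
    exact ⟨flagCone_isFaceOf hE hc.2 inter_subset_left,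
      flagCone_isFaceOf hE hc'.2 inter_subset_right⟩

lemma flagCone_mem_facets_iff [Finite α] (hE : N.E = univ) (hc : N.IsFlag c) :
    N.flagCone c ∈ Facets N.loopfreeFan ↔ N.IsMaximalFlag c := by
  constructor
  · refine fun h => ⟨hc, fun c' hc' hcc' => ?_⟩
    exact (flagCone_le_iff hE hc' hc).1 (h.le_of_ge ⟨c', hc', rfl⟩ (flagCone_mono hcc'))
  · refine fun h => ⟨⟨c, hc, rfl⟩, ?_⟩
    rintro _ ⟨c', hc', rfl⟩ hle
    exact flagCone_mono (h.le_of_ge hc' ((flagCone_le_iff hE hc hc').1 hle))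

lemma exists_eq_flagCone_of_mem_facets [Finite α] (hE : N.E = univ) {σ : PointedCone ℝ (α → ℝ)}
    (hσ : σ ∈ Facets N.loopfreeFan) : ∃ c, N.IsMaximalFlag c ∧ σ = N.flagCone c := by
  obtain ⟨c, hc, rfl⟩ := hσ.prop
  exact ⟨c, (flagCone_mem_facets_iff hE hc).1 hσ, rfl⟩

/-! ### Tangent spaces of cones of flags -/

lemma coneTangent_flagCone (N : Matroid α) (c : Set (Set α)) :
    coneTangent (N.flagCone c) =
      Submodule.span ℝ ((fun F : Set α => F.indicator (1 : α → ℝ)) '' N.extendedFlag c) := by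
  rw [coneTangent, flagCone, PointedCone.hull, Submodule.span_span_of_tower]
  have hmem : ∀ F ∈ insert N.E c, F.indicator (1 : α → ℝ) ∈
      Submodule.span ℝ ((fun F : Set α => F.indicator (1 : α → ℝ)) '' N.extendedFlag c) := by
    intro F hF
    rcases F.eq_empty_or_nonempty with rfl | hne
    · rw [indicator_empty]; exact Submodule.zero_mem _
    · exact Submodule.subset_span ⟨F, ⟨hF, hne⟩, rfl⟩
  refine le_antisymm (Submodule.span_le.2 ?_) (Submodule.span_le.2 ?_)
  · rintro _ (⟨F, hF, rfl⟩ | rfl | rfl)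
    · exact Submodule.neg_mem _ (hmem F (mem_insert_of_mem _ hF))
    · exact Submodule.neg_mem _ (hmem _ (mem_insert _ _))
    · rw [flatVector, neg_neg]; exact hmem _ (mem_insert _ _)
  · rintro _ ⟨F, ⟨rfl | hF, -⟩, rfl⟩
    · exact Submodule.subset_span (Or.inr (Or.inr (neg_neg _).symm))
    · rw [SetLike.mem_coe, ← Submodule.neg_mem_iff]
      exact Submodule.subset_span (Or.inl ⟨F, hF, rfl⟩)

lemma coneDim_flagCone [Finite α] (hc : N.IsFlag c) :
    coneDim (N.flagCone c) = (N.extendedFlag c).ncard := by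
  rw [coneDim, N.coneTangent_flagCone c,
    finrank_span_indicator hc.isChain fun F hF => hF.2]

/-- For a chain, lying in the span of the indicators is a condition of constancy on the steps, over
any commutative ring. It passes from an integer point to its reduction, so no lattice basis is
needed. -/
lemma coneTangentMod2_flagCone [Finite α] (hE : N.E = univ) (hc : N.IsFlag c) :
    coneTangentMod2 (N.flagCone c) =
      Submodule.span (ZMod 2)
        ((fun F : Set α => F.indicator (1 : α → ZMod 2)) '' N.extendedFlag c) := by
  have htan := N.coneTangent_flagCone c
  refine le_antisymm ?_ (Submodule.span_le.2 ?_)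
  · rintro _ ⟨z, hz, rfl⟩
    have hz' : (fun i => (z i : ℝ)) ∈ coneTangent (N.flagCone c) := hz
    rw [htan] at hz'
    refine mem_span_indicator hc.isChain (fun i j hij => ?_) fun i hi => ?_
    · have : (z i : ℝ) = z j := eq_of_mem_span_indicator hz' hij
      simp [Int.cast_injective this]
    · exact absurd (hE ▸ mem_univ i) (hi N.E ⟨mem_insert _ _, ⟨i, hE ▸ mem_univ i⟩⟩)
  · rintro _ ⟨F, hF, rfl⟩
    refine ⟨F.indicator 1, ?_, ?_⟩
    · change (fun i => ((F.indicator 1 i : ℤ) : ℝ)) ∈ coneTangent (N.flagCone c)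
      rw [htan]
      refine Submodule.subset_span ⟨F, hF, ?_⟩
      ext i
      by_cases h : i ∈ F <;> simp [h]
    · ext i
      by_cases h : i ∈ F <;> simp [h]

end Matroid

/-! ### The real phase structure -/

namespace OrientedMatroid

variable {α : Type*} [Finite α] {O : OrientedMatroid α}

/-- The phase of a maximal flag is an affine space parallel to the tangent space of its cone. -/
lemma phase_eq_affineSubspace [O.underlying.Loopless] {c : Set (Set α)}
    (hc : O.underlying.IsMaximalFlag c) {ε₀ : α → ZMod 2} (hε₀ : ε₀ ∈ O.phase c) :
    (AffineSubspace.mk' ε₀ (coneTangentMod2 (O.underlying.flagCone c)) : Set (α → ZMod 2)) =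
      O.phase c := by
  ext ε
  rw [SetLike.mem_coe, AffineSubspace.mem_mk', vsub_eq_sub,
    Matroid.coneTangentMod2_flagCone rfl hc.prop]
  constructor
  · intro h
    -- Quantifying over all `ε` in the phase lets the translations be composed in the induction on
    -- `v`.
    suffices H : ∀ v ∈ Submodule.span (ZMod 2)
        ((fun F : Set α => F.indicator (1 : α → ZMod 2)) '' O.underlying.extendedFlag c),
        ∀ ε ∈ O.phase c, ε + v ∈ O.phase c by
      simpa using H _ h ε₀ hε₀
    intro v hv
    induction hv using Submodule.span_induction with
    | mem v hv =>
      obtain ⟨F, hF, rfl⟩ := hv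
      exact fun ε hε => add_indicator_mem_phase hc.prop hF hε
    | zero => intro ε hε; rwa [add_zero]
    | add v w _ _ hv hw => intro ε hε; rw [← add_assoc]; exact hw _ (hv _ hε)
    | smul a v _ hv =>
      intro ε hε
      rcases (show ∀ a : ZMod 2, a = 0 ∨ a = 1 by decide) a with rfl | rfl
      · rwa [zero_smul, add_zero]
      · rw [one_smul]; exact hv _ hε
  · intro h
    refine mem_span_indicator hc.prop.isChain (fun i j hij => sub_eq_of_mem_phase hc h hε₀ hij) ?_
    exact fun i hi => absurd (mem_univ i) (hi univ ⟨mem_insert _ _, ⟨i, mem_univ i⟩⟩)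

/-- The type of `𝓔` depends on the matroid, and `loopfreePart_eq` is only a propositional equality;
a variable `N` allows substitution in place of transport. -/
theorem isRealPhaseStructure_loopfreeFan {N : Matroid α} (hN : N = O.underlying) [N.Loopless]
    {d : ℕ} (hd : N.eRank = d) {𝓔 : Facets N.loopfreeFan → Set (α → ZMod 2)}
    (h𝓔 : ∀ c (h : N.flagCone c ∈ Facets N.loopfreeFan), N.IsMaximalFlag c →
      𝓔 ⟨N.flagCone c, h⟩ = O.phase c) :
    IsRealPhaseStructure N.loopfreeFan d 𝓔 := by
  subst hN
  have hE : O.underlying.E = univ := rfl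
  have hrk : O.underlying.natRk O.underlying.E = d := by
    rw [Matroid.natRk, Matroid.eRk_ground, hd, ENat.toNat_natCast]
  have hdim : ∀ c, O.underlying.IsMaximalFlag c → coneDim (O.underlying.flagCone c) = d := fun c hc => by
    rw [Matroid.coneDim_flagCone hc.prop, hc.ncard_eq, hrk]
  refine ⟨Matroid.isRationalFan_loopfreeFan hE, ?_, ?_, ?_⟩
  · intro σ hσ
    obtain ⟨c, hc, rfl⟩ := Matroid.exists_eq_flagCone_of_mem_facets hE hσ
    exact hdim c hc
  · rintro ⟨σ, hσ⟩
    obtain ⟨c, hc, rfl⟩ := Matroid.exists_eq_flagCone_of_mem_facets hE hσ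
    obtain ⟨ε₀, hε₀⟩ := O.phase_nonempty hc.prop
    have hA := phase_eq_affineSubspace hc hε₀
    refine ⟨AffineSubspace.mk' ε₀ (coneTangentMod2 (O.underlying.flagCone c)), ?_, ?_, ?_,
      AffineSubspace.direction_mk' _ _⟩
    · rw [h𝓔 c hσ hc, hA]
    · rw [hA]; exact ⟨ε₀, hε₀⟩
    · rw [AffineSubspace.direction_mk', Matroid.coneTangentMod2_flagCone hE hc.prop,
        finrank_span_indicator hc.prop.isChain fun F hF => hF.2, hc.ncard_eq, hrk]
  · rintro _ ⟨c, hc, rfl⟩ hcd ε hε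
    have hcard : (O.underlying.extendedFlag c).ncard + 1 = O.underlying.natRk O.underlying.E := by
      rw [hrk, ← hcd, Matroid.coneDim_flagCone hc]
    obtain ⟨⟨⟨σ, hσ⟩, hface⟩, hεσ⟩ := mem_iUnion.1 hε
    obtain ⟨c₀, hc₀, rfl⟩ := Matroid.exists_eq_flagCone_of_mem_facets hE hσ
    dsimp only at hεσ hface
    rw [h𝓔 c₀ hσ hc₀] at hεσ
    obtain ⟨c₁, hcc₁, hne, hc₁, hε₁, huniq⟩ := exists_opposite_flag
      ((Matroid.isFaceOf_flagCone_iff hE hc hc₀.prop).1 hface) hc₀ hcard hεσ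
    have hσ₁ := (Matroid.flagCone_mem_facets_iff hE hc₁.prop).2 hc₁
    have hface₁ := (Matroid.isFaceOf_flagCone_iff hE hc hc₁.prop).2 hcc₁
    -- The facets around the cone whose phase contains `ε` are exactly the two given by `c₀` and
    -- `c₁`.
    have hset : {k : {σ : Facets O.underlying.loopfreeFan //
        (O.underlying.flagCone c).IsFaceOf (σ : PointedCone ℝ (α → ℝ))} | ε ∈ 𝓔 k.1} =
        {⟨⟨O.underlying.flagCone c₀, hσ⟩, hface⟩, ⟨⟨O.underlying.flagCone c₁, hσ₁⟩, hface₁⟩} := by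
      ext ⟨⟨σ, hσ₂⟩, hface₂⟩
      obtain ⟨c₂, hc₂, rfl⟩ := Matroid.exists_eq_flagCone_of_mem_facets hE hσ₂
      simp only [mem_ofPred_eq, mem_insert_iff, mem_singleton_iff, Subtype.mk.injEq]
      rw [h𝓔 c₂ hσ₂ hc₂]
      constructor
      · intro h
        rcases huniq c₂ ((Matroid.isFaceOf_flagCone_iff hE hc hc₂.prop).1 hface₂) hc₂ h
          with rfl | rfl
        exacts [Or.inl rfl, Or.inr rfl]
      · rintro (h | h)
        · rwa [Matroid.flagCone_inj hE hc₂.prop hc₀.prop h]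
        · rwa [Matroid.flagCone_inj hE hc₂.prop hc₁.prop h]
    beta_reduce
    rw [hset]
    refine ⟨toFinite _, ?_⟩
    rw [ncard_pair]
    · exact even_two
    · simp only [ne_eq, Subtype.mk.injEq]
      exact fun h => hne (Matroid.flagCone_inj hE hc₀.prop hc₁.prop h).symm

end OrientedMatroid

end

theorem proposition3p5 {E : Type*} [Finite E] (O : OrientedMatroid E) (d : ℕ)
    (hd : O.underlying.eRank = d) :
    (∀ c : Set (Set O.NonLoop), O.underlying.loopfreePart.IsMaximalFlag c →
      ∃ h : O.underlying.loopfreePart.flagCone c ∈ Facets O.underlying.affineFan,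
        O.realPhase ⟨O.underlying.loopfreePart.flagCone c, h⟩ = O.flagPhase c) ∧
    IsRealPhaseStructure O.underlying.affineFan d O.realPhase := by
  have hE : O.underlying.loopfreePart.E = univ := Matroid.restrictSubtype_ground
  have hphase : ∀ c (h : O.underlying.loopfreePart.flagCone c ∈ Facets O.underlying.affineFan),
      O.underlying.loopfreePart.IsMaximalFlag c →
      O.realPhase ⟨O.underlying.loopfreePart.flagCone c, h⟩ = O.flagPhase c := by
    intro c h hc
    ext ε
    constructor
    -- A cone determines its flag, so the existential in `realPhase` involves no choice.
    · rintro ⟨c', hc', heq, hε⟩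
      rwa [← Matroid.flagCone_inj hE hc'.prop hc.prop heq]
    · exact fun hε => ⟨c, hc, rfl, hε⟩
  have : O.underlying.loopfreePart.Loopless := by
    rw [O.loopfreePart_eq]
    exact O.deleteLoops_underlying_loopless
  refine ⟨fun c hc => ?_, ?_⟩
  · have h := (Matroid.flagCone_mem_facets_iff hE hc.prop).2 hc
    exact ⟨h, hphase c h hc⟩
  · exact OrientedMatroid.isRealPhaseStructure_loopfreeFan O.loopfreePart_eq
      (O.loopfreePart_eRank.trans hd) hphase
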